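/- **Conventions.** $G=(V,E)$ is an unweighted graph on $n$ vertices with Laplacian $L_G$; for $\gamma\ge 0$, $G^\gamma$ is the network with Laplacian $L_G+\gamma I$. $\widetilde G$ is a graph on $V$ with nonnegative edge weights $w$, possibly with a regularization $\tilde\gamma\ge 0$; write $\widetilde B=W^{1/2}B_n\oplus\sqrt{\tilde\gamma}\,I$ (the weighted rows $\sqrt{w_e}\,\mathbf b_e$ followed by those of $\sqrt{\tilde\gamma}I$) and $\widetilde L=\widetilde B^\top\widetilde B$. The effective resistance between $u,v$ in a network with Laplacian $L$ is $R_{uv}=\mathbf b_{uv}^\top L^+\mathbf b_{uv}$, $\mathbf b_{uv}=\chi_u-\chi_v$, and $R_{uv}=\infty$ if $\mathbf b_{uv}$ is not in the range of $L$ (that is, if $u,v$ are not connected). The connectivity of an edge $\{u,v\}$ is the size of a minimum $u$–$v$ cut. $\widetilde O(f)$ means at most $K(\log n)^c f$ with constants $K,c$. **The procedure $\textsc{BallCarving}(SB,E',r,\widetilde G)$.** Here $B$ is the vertex-edge incidence matrix of $G$ and $S$ a sketching matrix with $\operatorname{polylog}(n)$ rows. (1) Update $SB$ by removing the edges of $E'$.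 (2) Run the decoder $\textsc{SpanningForest}$ on the updated sketch to get the connected components of $G'=(V,E\setminus E')$. (3) Put $q=\lceil 10^6\log n\rceil$, let $Q$ be a uniformly random $\pm1$ matrix with $q$ rows, and compute $M=q^{-1/2}Q\widetilde B\widetilde L^+$; write $R^M_{uv}=\frac54\|M\mathbf b_{uv}\|_2^2$. (4) Set $V_{\rm active}=V'=V$. While $V_{\rm active}\neq\emptyset$, let $u$ be its next vertex in a fixed arbitrary order $\pi$, and $C^*$ the component of $G'$ containing $u$. If $\max_{v\in C^*}R^M_{uv}\le r/2$, remove $C^*$ from $V_{\rm active}$. Otherwise output the set $P=\{u\}\cup\{v\in V': R^M_{uv}\le r\}$ and remove $P$ from $V_{\rm active}$ and from $V'$. **Cost model.** Unit-cost real RAM, in which the two subroutines that are used as black boxes are charged nearly linear time and space: a call of $\textsc{SpanningForest}$ is charged $n\operatorname{polylog}(n)$, and applying $\widetilde L^+$ to a vector is charged $(\widetilde m+n)\operatorname{polylog}(n)$, where $\widetilde m$ is the number of edges of $\widetilde G$. **Theorem.** Let $G=(V,E)$ be a graph on $n$ vertices and $E'\subseteq E$, and suppose: 1. The minimum degree of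 $G$ is at least $d\ge 1$. 2. For some $\Gamma\ge1$, $0<r\le 1/\log n$, an integer $k\ge1$ and some $\Delta\in(0,1)$ with $\Delta<\frac{r/\Gamma}{800\sqrt k}$, $V$ has a partition $V=C_1\cup\dots\cup C_k$ such that each induced subgraph $G_{C_i}$ has effective resistance diameter at most $\Delta$. 3. For some $\gamma\ge0$ such that $G^\gamma$ is connected (that is, $\gamma>0$ or $G$ is connected), $R^{G^\gamma}_{uv}\le R^{\widetilde G}_{uv}\le 2\Gamma R^{G^\gamma}_{uv}$ for all $u,v\in V$; and $\widetilde G$ has at most $\frac{n}{\epsilon^2}\operatorname{polylog}(n)$ edges, where $\epsilon>0$. 4. $E'$ contains all edges of $G$ of connectivity at most $d$. 5. $SB$ is a sketch of the required kind: $S$ has at most $\operatorname{polylog}(n)$ rows and $\textsc{SpanningForest}$, applied to the sketch of $G'=(V,E\setminus E')$ under $S$, returns the connected components of $G'$. Then, for every order $\pi$, with probability at least $1-n^{-10}$ over $Q$: $\textsc{BallCarving}(SB,E',r,\widetilde G)$ returns pairwise disjoint sets $P$ with $R^{\widetilde G}_{uv}\le 2r$ for all $u,v\in P$; at most $\widetilde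 O\big(\sqrt k+\frac{k\Gamma}{rd}\big)$ of them are not singletons; the update of the sketch in step (1) takes $\widetilde O(|E'|)$ time, and all the remaining steps together take $\widetilde O\big(n\sqrt k+n\frac{k\Gamma}{rd}+\frac n{\epsilon^2}\big)$ time; the whole procedure uses $\widetilde O\big(n\sqrt k+n\frac{k\Gamma}{rd}+\frac n{\epsilon^2}\big)$ space (besides the list $E'$, which is only read once). The constants in $\widetilde O$ depend only on the exponents of the $\operatorname{polylog}(n)$ factors above. -/

import Mathlib

noncomputable section

namespace BallCarving

/-! ### Effective resistance -/

/-- The vector `χ_u - χ_v`. -/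
def bvec {V : Type*} [DecidableEq V] (u v : V) : V → ℝ :=
  Pi.single u 1 - Pi.single v 1

open Classical in
/-- The Moore–Penrose pseudoinverse of a symmetric real matrix `A = U diag(μ) Uᵀ`, namely
`U diag(μ⁺) Uᵀ` with `μ⁺ = μ⁻¹` for `μ ≠ 0` and `0⁺ = 0`.  (It is only used for symmetric
matrices; `isPseudoinverse_pinv` checks the defining equations.) -/
def pinv {V : Type*} [Fintype V] [DecidableEq V] (A : Matrix V V ℝ) : Matrix V V ℝ :=
  if h : A.IsHermitian then
    (h.eigenvectorUnitary : Matrix V V ℝ) * Matrix.diagonal (fun i => (h.eigenvalues i)⁻¹) *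
      (star h.eigenvectorUnitary : Matrix V V ℝ)
  else 0

/-- The four Penrose equations characterising the pseudoinverse. -/
theorem isPseudoinverse_pinv {V : Type*} [Fintype V] [DecidableEq V] (A : Matrix V V ℝ)
    (h : A.IsHermitian) :
    A * pinv A * A = A ∧ pinv A * A * pinv A = pinv A ∧
      (A * pinv A).IsHermitian ∧ (pinv A * A).IsHermitian := by
  have hp : pinv A = (h.eigenvectorUnitary : Matrix V V ℝ) *
      Matrix.diagonal (fun i => (h.eigenvalues i)⁻¹) *
      (star h.eigenvectorUnitary : Matrix V V ℝ) := by
    rw [pinv, dif_pos h]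
  have hA : A = (h.eigenvectorUnitary : Matrix V V ℝ) * Matrix.diagonal h.eigenvalues *
      (star h.eigenvectorUnitary : Matrix V V ℝ) := by
    have := h.spectral_theorem
    simpa [Unitary.conjStarAlgAut_apply, Function.comp_def] using this
  have hU : (star h.eigenvectorUnitary : Matrix V V ℝ) * (h.eigenvectorUnitary : Matrix V V ℝ) = 1 :=
    Unitary.coe_star_mul_self h.eigenvectorUnitary
  set U : Matrix V V ℝ := (h.eigenvectorUnitary : Matrix V V ℝ)
  set W : Matrix V V ℝ := (star h.eigenvectorUnitary : Matrix V V ℝ)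
  have key : ∀ f g : V → ℝ, U * Matrix.diagonal f * W * (U * Matrix.diagonal g * W) =
      U * Matrix.diagonal (fun i => f i * g i) * W := by
    intro f g
    calc _ = U * Matrix.diagonal f * (W * U) * Matrix.diagonal g * W := by
          simp only [Matrix.mul_assoc]
      _ = _ := by
          rw [hU, Matrix.mul_one, Matrix.mul_assoc U, Matrix.diagonal_mul_diagonal]
  have herm : ∀ f : V → ℝ, (U * Matrix.diagonal f * W).IsHermitian := by
    intro f
    have hW : W = U.conjTranspose := rfl
    rw [hW]
    exact Matrix.isHermitian_mul_mul_conjTranspose U (Matrix.isHermitian_diagonal f)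
  have e1 : A * pinv A = U * Matrix.diagonal
      (fun i => h.eigenvalues i * (h.eigenvalues i)⁻¹) * W := by
    rw [hp, ← key, ← hA]
  have e2 : pinv A * A = U * Matrix.diagonal
      (fun i => (h.eigenvalues i)⁻¹ * h.eigenvalues i) * W := by
    rw [hp, ← key, ← hA]
  refine ⟨?_, ?_, e1 ▸ herm _, e2 ▸ herm _⟩
  · conv_lhs => rw [e1]; rhs; rw [hA]
    rw [key]
    conv_rhs => rw [hA]
    congr 3
    funext i
    exact mul_inv_mul_cancel _
  · rw [e2, hp, key]
    congr 3
    funext i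
    by_cases hi : h.eigenvalues i = 0 <;> simp [hi]

open Classical in
/-- Effective resistance between `u` and `v` in the network with (possibly regularized) Laplacian
`L`: it is `b_{uv}ᵀ L⁺ b_{uv}` if a unit current can be sent from `u` to `v`, that is if
`b_{uv}` lies in the range of `L`, and it is infinite otherwise. -/
def effRes {V : Type*} [Fintype V] [DecidableEq V] (L : Matrix V V ℝ) (u v : V) : ENNReal :=
  if ∃ x : V → ℝ, L.mulVec x = bvec u v then
    ENNReal.ofReal (bvec u v ⬝ᵥ (pinv L).mulVec (bvec u v))
  else ⊤

open Classical in
/-- The Laplacian of an unweighted graph. -/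
def lap {V : Type*} [Fintype V] [DecidableEq V] (G : SimpleGraph V) : Matrix V V ℝ :=
  G.lapMatrix ℝ

/-- The Laplacian `L_G + γ I` of the regularized graph `G^γ`. -/
def lapReg {V : Type*} [Fintype V] [DecidableEq V] (G : SimpleGraph V) (γ : ℝ) :
    Matrix V V ℝ :=
  lap G + γ • (1 : Matrix V V ℝ)

open Classical in
/-- The subgraph induced by `C` has effective resistance diameter at most `Δ`. -/
def InducedDiamLE {V : Type*} [Fintype V] [DecidableEq V] (G : SimpleGraph V) (C : Set V)
    (Δ : ℝ) : Prop :=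
  ∀ u v : C, effRes (lap (G.induce C)) u v ≤ ENNReal.ofReal Δ

open Classical in
/-- The number of neighbours of `v`. -/
def deg {V : Type*} [Fintype V] (G : SimpleGraph V) (v : V) : ℕ := G.degree v

open Classical in
/-- The size of a minimum cut separating `u` from `v`. -/
def edgeConn {V : Type*} [Fintype V] [DecidableEq V] (G : SimpleGraph V) (u v : V) : ℕ :=
  sInf {m | ∃ S : Finset V, u ∈ S ∧ v ∉ S ∧ (G.interedges S Sᶜ).card = m}

/-! ### Incidence matrices, weighted regularized graphs, sketches -/

/-- The `n.choose 2` unordered pairs of distinct vertices. -/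
abbrev Pairs (n : ℕ) : Type := {e : Sym2 (Fin n) // ¬ e.IsDiag}

/-- The row `χ_u - χ_v` of a pair `e = {u, v}`, oriented so that `u < v`. -/
def prow {n : ℕ} (e : Pairs n) : Fin n → ℝ := bvec e.1.inf e.1.sup

open Classical in
/-- The vertex-edge incidence matrix of `G`; rows of non-edges are zero. -/
def incidence {n : ℕ} (G : SimpleGraph (Fin n)) : Matrix (Pairs n) (Fin n) ℝ :=
  fun e x => if e.1 ∈ G.edgeSet then prow e x else 0

/-- `G` with the edges in `F` removed. -/
def without {n : ℕ} (G : SimpleGraph (Fin n)) (F : Finset (Pairs n)) : SimpleGraph (Fin n) :=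
  G.deleteEdges (Subtype.val '' (F : Set (Pairs n)))

/-- A graph with nonnegative edge weights (weight `0` means no edge), plus a regularization
`reg · I`; a plain weighted graph has `reg = 0`. -/
structure WGraph (n : ℕ) where
  w : Pairs n → ℝ
  reg : ℝ
  w_nonneg : ∀ e, 0 ≤ w e
  reg_nonneg : 0 ≤ reg

namespace WGraph

variable {n : ℕ} (H : WGraph n)

/-- The matrix `W^{1/2} B ⊕ √reg I`. -/
def inc : Matrix (Pairs n ⊕ Fin n) (Fin n) ℝ :=
  Matrix.of (Sum.elim (fun e => Real.sqrt (H.w e) • prow e)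
    (fun v => Real.sqrt H.reg • Pi.single v 1))

/-- The Laplacian `Bᵀ W B + reg · I`. -/
def laplacian : Matrix (Fin n) (Fin n) ℝ := H.inc.transpose * H.inc

open Classical in
/-- The edges. -/
def edges : Finset (Pairs n) := Finset.univ.filter fun e => H.w e ≠ 0

end WGraph

/-! ### Cost model

Unit-cost real RAM: one elementary operation on vertices or reals (arithmetic, square root,
comparison, reading or writing one memory cell, drawing one random sign) is one time step, one
memory cell holds one vertex or one real.  No memory is reused, so `space`, the number of cells
ever reserved, bounds the peak memory.  The two black boxes that the procedure invokes, the decoder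
`SpanningForest` and a solver for linear systems in a Laplacian, are subroutines whose time and
space are charged as `size * (⌊log₂ n⌋ + 1) ^ a`, for an arbitrary exponent `a`. -/

/-- A result together with the time and space spent on computing it. -/
structure Costed (α : Type) where
  val : α
  time : ℕ
  space : ℕ

instance : Monad Costed where
  pure x := ⟨x, 0, 0⟩
  bind x f := ⟨(f x.val).val, x.time + (f x.val).time, x.space + (f x.val).space⟩

/-- `t` elementary operations. -/
def tick (t : ℕ) : Costed Unit := ⟨(), t, 0⟩

/-- Reserve and initialise `s` memory cells. -/
def alloc (s : ℕ) : Costed Unit := ⟨(), s, s⟩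

/-- The charge of a nearly-linear-time subroutine on an input of the given size. -/
def nearlyLinear (a n size : ℕ) : ℕ := size * (Nat.log 2 n + 1) ^ a

/-! ### The procedure -/

variable {n : ℕ}

/-- First step: update the sketch `Y = S B` by removing the edges in `F`.  Removing one edge changes
two entries in each of the `s` rows. -/
def removeEdges {s : ℕ} (S : Matrix (Fin s) (Pairs n) ℝ) (Y : Matrix (Fin s) (Fin n) ℝ)
    (F : Finset (Pairs n)) : Costed (Matrix (Fin s) (Fin n) ℝ) :=
  F.toList.foldlM (fun Y e => do
    tick (1 + 10 * s)
    pure (Matrix.of fun i x => Y i x - S i e * prow e x)) Y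

/-- The subroutine `SpanningForest`, run on a sketch; `decode` returns a component label for each
vertex. -/
def spanningForest (a : ℕ) {s : ℕ} (decode : Matrix (Fin s) (Fin n) ℝ → Fin n → Fin n)
    (Y : Matrix (Fin s) (Fin n) ℝ) : Costed (Fin n → Fin n) := do
  alloc (nearlyLinear a n n)
  pure (decode Y)

/-- For each label, the list of the vertices carrying it. -/
def componentLists (label : Fin n → Fin n) : Costed (Fin n → List (Fin n)) := do
  alloc n
  (List.finRange n).foldlM (fun T v => do
    tick 4
    alloc 2
    pure (Function.update T (label v) (v :: T (label v)))) (fun _ => [])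

/-- The number of rows of the embedding. -/
def numRows (n : ℕ) : ℕ := ⌈10 ^ 6 * Real.log n⌉₊

/-- The sign of a random bit. -/
def sgn (b : Bool) : ℝ := if b then 1 else -1

/-- The sample space: sign matrices with `numRows n` rows and one column per row of `WGraph.inc`.
(For `reg = 0` the columns beyond the `n.choose 2` first ones are multiplied by `0`.) -/
abbrev Signs (n : ℕ) : Type := Fin (numRows n) → (Pairs n ⊕ Fin n) → Bool

/-- The subroutine that applies the pseudoinverse of the Laplacian to a vector. -/
def laplacianSolve (a : ℕ) (H : WGraph n) (y : Fin n → ℝ) : Costed (Fin n → ℝ) := do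
  alloc (nearlyLinear a n (H.edges.card + n))
  pure ((pinv H.laplacian).mulVec y)

/-- The combination `σᵀ B̃` of the rows of `B̃`, with random signs `σ`: only the rows of the
edges and the regularization rows are touched. -/
def combineRows (H : WGraph n) (σ : Pairs n ⊕ Fin n → Bool) : Costed (Fin n → ℝ) := do
  alloc n
  let y ← H.edges.toList.foldlM (fun y e => do
    tick 14
    pure (y + (sgn (σ (Sum.inl e)) * Real.sqrt (H.w e)) • prow e)) (0 : Fin n → ℝ)
  (List.finRange n).foldlM (fun y v => do
    tick 7
    pure (Function.update y v (y v + sgn (σ (Sum.inr v)) * Real.sqrt H.reg))) y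

/-- The matrix `M = q^{-1/2} Q B̃ L̃⁺`, computed row by row (`L̃⁺` is symmetric). -/
def embedding (a : ℕ) (H : WGraph n) (Q : Signs n) :
    Costed (Matrix (Fin (numRows n)) (Fin n) ℝ) := do
  alloc (numRows n * n)
  (List.finRange (numRows n)).foldlM (fun M i => do
    let y ← combineRows H (Q i)
    let x ← laplacianSolve a H y
    tick (3 + 4 * n)
    pure (M.updateRow i ((Real.sqrt (numRows n))⁻¹ • x))) 0

/-- `‖M (χ_u - χ_v)‖²`. -/
def sqDist {q : ℕ} (M : Matrix (Fin q) (Fin n) ℝ) (u v : Fin n) : Costed ℝ :=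
  (List.finRange q).foldlM (fun s i => do
    tick 6
    pure (s + (M i u - M i v) ^ 2)) 0

/-- `R^M_{uv} = (5/4) ‖M (χ_u - χ_v)‖²`. -/
def resM {q : ℕ} (M : Matrix (Fin q) (Fin n) ℝ) (u v : Fin n) : Costed ℝ := do
  let s ← sqDist M u v
  tick 1
  pure (5 / 4 * s)

/-- `R^M_{u,C} = max_{v ∈ C} R^M_{uv}`. -/
def maxResM {q : ℕ} (M : Matrix (Fin q) (Fin n) ℝ) (u : Fin n) (C : List (Fin n)) :
    Costed ℝ :=
  C.foldlM (fun R v => do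
    let s ← resM M u v
    tick 4
    pure (max R s)) 0

/-- The set `{u} ∪ {v ∈ A \ {u} : R^M_{uv} ≤ r}`; sets are stored as lists and subsets `A` of the
vertex set as Boolean arrays. -/
def carve {q : ℕ} (M : Matrix (Fin q) (Fin n) ℝ) (r : ℝ) (A : Finset (Fin n)) (u : Fin n) :
    Costed (Finset (Fin n)) := do
  alloc 2
  (List.finRange n).foldlM (fun P v => do
    tick 4
    if v ∈ A \ {u} then
      let s ← resM M u v
      tick 1
      if s ≤ r then
        alloc 2
        pure (insert v P)
      else pure P
    else pure P) {u}

/-- The variables of the main loop: `V_active`, `V'` and the sets output so far. -/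
structure LoopState (n : ℕ) where
  active : Finset (Fin n)
  rest : Finset (Fin n)
  out : List (Finset (Fin n))

/-- One iteration of the main loop at the vertex `u`; vertices that are no longer active are
skipped. -/
def visit {q : ℕ} (M : Matrix (Fin q) (Fin n) ℝ) (r : ℝ) (comp : Fin n → List (Fin n))
    (X : LoopState n) (u : Fin n) : Costed (LoopState n) := do
  tick 3
  if u ∈ X.active then
    let R ← maxResM M u (comp u)
    tick 4
    if R ≤ r / 2 then
      tick (3 * (comp u).length)
      pure { X with active := X.active \ (comp u).toFinset }
    else
      let P ← carve M r X.rest u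
      tick (6 * P.card)
      alloc 2
      pure { active := X.active \ P, rest := X.rest \ P, out := X.out ++ [P] }
  else pure X

/-- All the steps after the update of the sketch.  The active vertices are visited
in the order `π 0, π 1, …`; as `V_active` only shrinks, and loses every visited vertex, one pass
through this order visits the next active vertex each time, until none is left. -/
def carveFromSketch (a : ℕ) {s : ℕ} (decode : Matrix (Fin s) (Fin n) ℝ → Fin n → Fin n)
    (Y : Matrix (Fin s) (Fin n) ℝ) (r : ℝ) (H : WGraph n) (π : Equiv.Perm (Fin n))
    (Q : Signs n) : Costed (List (Finset (Fin n))) := do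
  alloc (s * n + 3 * H.edges.card + 2) -- room for the sketch, the graph `H` and `r`
  let label ← spanningForest a decode Y
  let lists ← componentLists label
  let M ← embedding a H Q
  alloc (2 * n) -- room for `V_active` and `V'`
  let X ← ((List.finRange n).map π).foldlM (visit M r fun u => lists (label u))
    { active := Finset.univ, rest := Finset.univ, out := [] }
  pure X.out

/-- The procedure `BallCarving(S B, F, r, H)` with vertex order `π` and random signs `Q`. -/
def ballCarving (a : ℕ) {s : ℕ} (S : Matrix (Fin s) (Pairs n) ℝ)
    (decode : Matrix (Fin s) (Fin n) ℝ → Fin n → Fin n) (Y : Matrix (Fin s) (Fin n) ℝ)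
    (F : Finset (Pairs n)) (r : ℝ) (H : WGraph n) (π : Equiv.Perm (Fin n)) (Q : Signs n) :
    Costed (List (Finset (Fin n))) := do
  let Z ← removeEdges S Y F
  carveFromSketch a decode Z r H π Q

end BallCarving

end

/-!
Let `R` be the effective resistance of `G^γ`, a metric up to zero distances. With high probability
the random signs preserve the norms of the at most `n²` edge currents `B̃ L̃⁺ (χ_u - χ_v)`, so that
`R^M` lies between the resistance of `H` and `3 Γ R`. The centres of the sets in the output are then
more than `8 ρ` apart for `R`, where `ρ = r / (24 Γ)`, and each has a vertex at distance more than
`ρ` in its component of the pruned graph, whence their connectivity exceeds `d`.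

An edge is long if its resistance is at least `θ = Δ / δ²`, where `δ` has the order of `1 / log² n`.
For `R₀ ≥ θ`, the unit potential of an edge of resistance at least `R₀` has energy at most `1 / R₀`
and varies by at most `δ` on each cluster. A sweep over its level sets, by region growing, finds a
sparse cut in the graph of clusters whose edges are those of resistance at least `R₀`. Cutting
recursively, there are at most `4 k / (δ² R₀)` such edges, and hence the total resistance of the
long edges is at most `Õ(k)`.

A ball of radius `2 ρ` that meets about `ρ / θ` clusters uses up that many of the `k` clusters,
which happens for at most `Õ(k θ / ρ) = Õ(√k)` centres. Around any other centre most of the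
multiples of `θ` up to `ρ` are radii of balls whose boundary consists of long edges only; as these
boundaries are cuts with at least `d` edges, the ball contains long edges of total resistance
`Ω(d ρ)`. Since the balls are disjoint, there are at most `Õ(k / (d ρ)) = Õ(k Γ / (r d))` such
centres.
-/

noncomputable section

namespace BallCarving

open scoped Matrix

section Energy

variable {V : Type*} [Fintype V] {L : Matrix V V ℝ}

lemma dotProduct_mulVec_comm (hL : L.IsHermitian) (x y : V → ℝ) :
    x ⬝ᵥ L *ᵥ y = y ⬝ᵥ L *ᵥ x := by
  have htranspose : L.transpose = L := by simpa [Matrix.IsHermitian] using hL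
  rw [Matrix.dotProduct_mulVec, ← Matrix.mulVec_transpose, htranspose, dotProduct_comm]

lemma dotProduct_mulVec_sq_le (hL : L.PosSemidef) (x y : V → ℝ) :
    (x ⬝ᵥ L *ᵥ y) ^ 2 ≤ (x ⬝ᵥ L *ᵥ x) * (y ⬝ᵥ L *ᵥ y) := by
  classical
  have hcs := (Matrix.toBilin' L).apply_sq_le_of_symm
    (fun z => by simpa [Matrix.toBilin'_apply'] using hL.dotProduct_mulVec_nonneg z)
    ⟨fun z w => by simpa [Matrix.toBilin'_apply'] using dotProduct_mulVec_comm hL.1 z w⟩ x y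
  simpa only [Matrix.toBilin'_apply'] using hcs

/-- The Laplacian of a network in which `a` and `b` are joined by the conductance `-L a b ≥ 0`, and
`a` is joined to the ground by the conductance `∑ b, L a b ≥ 0`; a regularization is a uniform
conductance to the ground. -/
structure IsNetworkLaplacian (L : Matrix V V ℝ) : Prop where
  isHermitian : L.IsHermitian
  off_diag_nonpos : ∀ a b, a ≠ b → L a b ≤ 0
  row_sum_nonneg : ∀ a, 0 ≤ ∑ b, L a b

lemma two_mul_dotProduct_mulVec (hL : L.IsHermitian) (x y : V → ℝ) :
    2 * (x ⬝ᵥ L *ᵥ y) = ∑ a, ∑ b, -L a b * ((x a - x b) * (y a - y b)) +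
      2 * ∑ a, (∑ b, L a b) * (x a * y a) := by
  have hxy : x ⬝ᵥ L *ᵥ y = ∑ a, ∑ b, L a b * (x a * y b) := by
    simp only [dotProduct, Matrix.mulVec, Finset.mul_sum]
    exact Finset.sum_congr rfl fun a _ => Finset.sum_congr rfl fun b _ => by ring
  have hswap (f : V → V → ℝ) : ∑ a, ∑ b, L a b * f a b = ∑ a, ∑ b, L a b * f b a := by
    rw [Finset.sum_comm]
    refine Finset.sum_congr rfl fun a _ => Finset.sum_congr rfl fun b _ => ?_
    rw [show L b a = L a b by simpa using hL.apply a b]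
  have hexpand : ∑ a, ∑ b, -L a b * ((x a - x b) * (y a - y b)) =
      ∑ a, ∑ b, L a b * (x a * y b) + ∑ a, ∑ b, L a b * (x b * y a) -
        ∑ a, ∑ b, L a b * (x a * y a) - ∑ a, ∑ b, L a b * (x b * y b) := by
    simp only [← Finset.sum_add_distrib, ← Finset.sum_sub_distrib]
    exact Finset.sum_congr rfl fun _ _ => Finset.sum_congr rfl fun _ _ => by ring
  rw [hexpand, hxy, ← hswap fun a b => x a * y b, ← hswap fun a _ => x a * y a]
  simp only [Finset.sum_mul]
  ring

lemma IsNetworkLaplacian.dotProduct_mulVec_nonneg (hL : IsNetworkLaplacian L) {x y : V → ℝ}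
    (hdiff : ∀ a b, 0 ≤ (x a - x b) * (y a - y b)) (hmul : ∀ a, 0 ≤ x a * y a) :
    0 ≤ x ⬝ᵥ L *ᵥ y := by
  have hedges : 0 ≤ ∑ a, ∑ b, -L a b * ((x a - x b) * (y a - y b)) := by
    refine Finset.sum_nonneg fun a _ => Finset.sum_nonneg fun b _ => ?_
    rcases eq_or_ne a b with rfl | hab
    · simp
    · exact mul_nonneg (neg_nonneg.2 (hL.off_diag_nonpos a b hab)) (hdiff a b)
  have hground : 0 ≤ ∑ a, (∑ b, L a b) * (x a * y a) :=
    Finset.sum_nonneg fun a _ => mul_nonneg (hL.row_sum_nonneg a) (hmul a)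
  linarith [two_mul_dotProduct_mulVec hL.isHermitian x y]

lemma IsNetworkLaplacian.posSemidef (hL : IsNetworkLaplacian L) : L.PosSemidef :=
  .of_dotProduct_mulVec_nonneg hL.isHermitian fun x => by
    simpa using hL.dotProduct_mulVec_nonneg (fun a b => mul_self_nonneg (x a - x b))
      fun a => mul_self_nonneg (x a)

lemma IsNetworkLaplacian.energy_comp_le (hL : IsNetworkLaplacian L) {f : ℝ → ℝ} (hf : Monotone f)
    (hf' : Monotone fun s => s - f s) (hf0 : f 0 = 0) (ψ : V → ℝ) :
    (f ∘ ψ) ⬝ᵥ L *ᵥ (f ∘ ψ) ≤ (f ∘ ψ) ⬝ᵥ L *ᵥ ψ := by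
  have hmono (s t : ℝ) : 0 ≤ (f s - f t) * ((s - f s) - (t - f t)) := by
    rcases le_total s t with hst | hst
    · exact mul_nonneg_of_nonpos_of_nonpos (sub_nonpos.2 (hf hst)) (sub_nonpos.2 (hf' hst))
    · exact mul_nonneg (sub_nonneg.2 (hf hst)) (sub_nonneg.2 (hf' hst))
  have hcross : 0 ≤ (f ∘ ψ) ⬝ᵥ L *ᵥ (ψ - f ∘ ψ) :=
    hL.dotProduct_mulVec_nonneg (fun a b => hmono (ψ a) (ψ b))
      fun a => by simpa [hf0] using hmono (ψ a) 0
  rwa [Matrix.mulVec_sub, dotProduct_sub, sub_nonneg] at hcross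

end Energy

section EffectiveResistance

lemma neg_bvec {V : Type*} [DecidableEq V] (u v : V) : -bvec u v = bvec v u :=
  neg_sub _ _

lemma bvec_add_bvec {V : Type*} [DecidableEq V] (u v w : V) :
    bvec u v + bvec v w = bvec u w :=
  sub_add_sub_cancel _ _ _

variable {V : Type*} [Fintype V] [DecidableEq V] {L : Matrix V V ℝ} {u v w : V}

/-- The quadratic form `b_{uv}ᵀ L⁺ b_{uv}`. It is the effective resistance only if
`CarriesCurrent L u v`; otherwise the effective resistance is infinite. -/
def reff (L : Matrix V V ℝ) (u v : V) : ℝ := bvec u v ⬝ᵥ pinv L *ᵥ bvec u v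

/-- A unit current can be sent from `u` to `v`, so that their effective resistance is finite. -/
def CarriesCurrent (L : Matrix V V ℝ) (u v : V) : Prop := ∃ x : V → ℝ, L *ᵥ x = bvec u v

lemma bvec_dotProduct (x : V → ℝ) (u v : V) : bvec u v ⬝ᵥ x = x u - x v := by
  simp [bvec, sub_dotProduct]

lemma dotProduct_bvec (x : V → ℝ) (u v : V) : x ⬝ᵥ bvec u v = x u - x v := by
  rw [dotProduct_comm, bvec_dotProduct]

lemma reff_self (L : Matrix V V ℝ) (u : V) : reff L u u = 0 := by
  simp [reff, bvec]

lemma reff_comm (L : Matrix V V ℝ) (u v : V) : reff L u v = reff L v u := by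
  rw [reff, reff, ← neg_bvec v u, Matrix.mulVec_neg, neg_dotProduct_neg]

lemma pinv_isHermitian (hL : L.IsHermitian) : (pinv L).IsHermitian := by
  rw [pinv, dif_pos hL]
  exact Matrix.isHermitian_mul_mul_conjTranspose _ (Matrix.isHermitian_diagonal _)

lemma mulVec_pinv_mulVec (hL : L.IsHermitian) {b : V → ℝ} (hb : ∃ x, L *ᵥ x = b) :
    L *ᵥ (pinv L *ᵥ b) = b := by
  obtain ⟨x, rfl⟩ := hb
  rw [Matrix.mulVec_mulVec, Matrix.mulVec_mulVec, (isPseudoinverse_pinv L hL).1]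

lemma effRes_eq_ofReal_reff (h : CarriesCurrent L u v) :
    effRes L u v = ENNReal.ofReal (reff L u v) := if_pos h

lemma carriesCurrent_of_effRes_ne_top (h : effRes L u v ≠ ⊤) : CarriesCurrent L u v := by
  by_contra hnot
  exact h (if_neg hnot)

lemma carriesCurrent_of_forall_ker (hL : L.IsHermitian)
    (hker : ∀ z, L *ᵥ z = 0 → z u = z v) : CarriesCurrent L u v := by
  obtain ⟨hLPL, -, hLP, -⟩ := isPseudoinverse_pinv L hL
  set b := bvec u v
  -- `z` is the component of `b` orthogonal to the range of `L`, which is the kernel of `L`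
  set z := b - (L * pinv L) *ᵥ b with hz
  have hLz_dot (y : V → ℝ) : z ⬝ᵥ L *ᵥ y = 0 := by
    have hproj : (L * pinv L) *ᵥ b ⬝ᵥ L *ᵥ y = b ⬝ᵥ L *ᵥ y := by
      rw [dotProduct_comm, dotProduct_mulVec_comm hLP, Matrix.mulVec_mulVec, hLPL]
    rw [hz, sub_dotProduct, hproj, sub_self]
  have hLz : L *ᵥ z = 0 := by
    rw [← dotProduct_self_eq_zero, dotProduct_comm, dotProduct_mulVec_comm hL]
    exact hLz_dot _
  have hzz : z ⬝ᵥ z = 0 := by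
    have hzb : z ⬝ᵥ b = 0 := by rw [dotProduct_bvec, hker z hLz, sub_self]
    calc z ⬝ᵥ z = z ⬝ᵥ b - z ⬝ᵥ L *ᵥ (pinv L *ᵥ b) := by
          rw [← dotProduct_sub, Matrix.mulVec_mulVec, ← hz]
      _ = 0 := by rw [hzb, hLz_dot, sub_self]
  refine ⟨pinv L *ᵥ b, ?_⟩
  rw [Matrix.mulVec_mulVec]
  exact (sub_eq_zero.1 (dotProduct_self_eq_zero.1 hzz)).symm

lemma energy_pinv_mulVec_bvec (hL : L.IsHermitian) (huv : CarriesCurrent L u v) :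
    pinv L *ᵥ bvec u v ⬝ᵥ L *ᵥ (pinv L *ᵥ bvec u v) = reff L u v := by
  rw [mulVec_pinv_mulVec hL huv, dotProduct_comm, reff]

lemma reff_nonneg (hL : L.PosSemidef) (huv : CarriesCurrent L u v) : 0 ≤ reff L u v := by
  rw [← energy_pinv_mulVec_bvec hL.1 huv]
  simpa using hL.dotProduct_mulVec_nonneg (pinv L *ᵥ bvec u v)

lemma sq_sub_le_reff_mul_energy (hL : L.PosSemidef) (huv : CarriesCurrent L u v) (x : V → ℝ) :
    (x u - x v) ^ 2 ≤ reff L u v * (x ⬝ᵥ L *ᵥ x) := by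
  have hcs := dotProduct_mulVec_sq_le hL x (pinv L *ᵥ bvec u v)
  rw [energy_pinv_mulVec_bvec hL.1 huv, mulVec_pinv_mulVec hL.1 huv, dotProduct_bvec] at hcs
  linarith

lemma reff_le_of_forall_sq_sub_le (hL : L.IsHermitian) (huv : CarriesCurrent L u v) {c : ℝ}
    (hc : 0 ≤ c) (h : ∀ x : V → ℝ, (x u - x v) ^ 2 ≤ c * (x ⬝ᵥ L *ᵥ x)) : reff L u v ≤ c := by
  have hpot := h (pinv L *ᵥ bvec u v)
  rw [energy_pinv_mulVec_bvec hL huv, ← bvec_dotProduct, ← reff] at hpot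
  by_contra! hlt
  nlinarith

lemma exists_unit_potential (hL : L.IsHermitian) (huv : CarriesCurrent L u v)
    (hR : reff L u v ≠ 0) :
    ∃ x : V → ℝ, x u - x v = 1 ∧ x ⬝ᵥ L *ᵥ x = (reff L u v)⁻¹ := by
  refine ⟨(reff L u v)⁻¹ • pinv L *ᵥ bvec u v, ?_, ?_⟩
  · rw [← bvec_dotProduct, dotProduct_smul, ← reff, smul_eq_mul, inv_mul_cancel₀ hR]
  · rw [Matrix.mulVec_smul, dotProduct_smul, smul_dotProduct, energy_pinv_mulVec_bvec hL huv,
      smul_eq_mul, smul_eq_mul, inv_mul_cancel₀ hR, mul_one]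

/-- Minimum principle: truncating the potential at its value in the sink `v` leaves a vector of
energy at most `0`. -/
lemma potential_sink_le (hL : IsNetworkLaplacian L) (huv : CarriesCurrent L u v)
    (hvw : CarriesCurrent L v w) :
    (pinv L *ᵥ bvec u v) v ≤ (pinv L *ᵥ bvec u v) w := by
  set ψ := pinv L *ᵥ bvec u v with hψ
  set f : ℝ → ℝ := fun s => min s (ψ v) - min 0 (ψ v) with hf
  have hmono : Monotone f := fun s t hst => sub_le_sub_right (min_le_min_right _ hst) _
  have hmono' : Monotone fun s => s - f s := fun s t hst => by
    simp only [hf, min_def]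
    split_ifs <;> linarith
  have henergy : (f ∘ ψ) ⬝ᵥ L *ᵥ (f ∘ ψ) ≤ 0 := by
    refine (hL.energy_comp_le hmono hmono' (sub_self _) ψ).trans ?_
    rw [hψ, mulVec_pinv_mulVec hL.isHermitian huv, ← hψ, dotProduct_bvec]
    simp [hf]
  have hconst : f (ψ v) = f (ψ w) := by
    have hsq := (sq_sub_le_reff_mul_energy hL.posSemidef hvw (f ∘ ψ)).trans
      (mul_nonpos_of_nonneg_of_nonpos (reff_nonneg hL.posSemidef hvw) henergy)
    exact sub_eq_zero.1 (pow_eq_zero_iff two_ne_zero |>.1 (hsq.antisymm (sq_nonneg _)))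
  simpa [hf] using hconst

lemma reff_triangle (hL : IsNetworkLaplacian L) (huv : CarriesCurrent L u v)
    (hvw : CarriesCurrent L v w) : reff L u w ≤ reff L u v + reff L v w := by
  have hcross : bvec v w ⬝ᵥ pinv L *ᵥ bvec u v ≤ 0 := by
    rw [bvec_dotProduct, sub_nonpos]
    exact potential_sink_le hL huv hvw
  have hexpand : reff L u w = reff L u v + reff L v w + 2 * (bvec v w ⬝ᵥ pinv L *ᵥ bvec u v) := by
    simp only [reff, ← bvec_add_bvec u v w, Matrix.mulVec_add, dotProduct_add, add_dotProduct,
      dotProduct_mulVec_comm (pinv_isHermitian hL.isHermitian) (bvec u v) (bvec v w)]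
    ring
  linarith

end EffectiveResistance

section Graph

variable {V : Type*} [Fintype V] [DecidableEq V] {G : SimpleGraph V}

/-- The Dirichlet energy of a potential on a graph, the sum of the squares `(x a - x b) ^ 2` over
the edges. -/
def energy (G : SimpleGraph V) (x : V → ℝ) : ℝ := x ⬝ᵥ lap G *ᵥ x

open Classical in
lemma two_mul_energy (G : SimpleGraph V) (x : V → ℝ) :
    2 * energy G x = ∑ a, ∑ b, if G.Adj a b then (x a - x b) ^ 2 else 0 := by
  rw [energy, lap, ← Matrix.toLinearMap₂'_apply', G.lapMatrix_toLinearMap₂' (R := ℝ) x]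
  exact mul_div_cancel₀ _ two_ne_zero

lemma isNetworkLaplacian_lap (G : SimpleGraph V) : IsNetworkLaplacian (lap G) where
  isHermitian := by classical exact G.isHermitian_lapMatrix ℝ
  off_diag_nonpos a b hab := by
    classical
    simp only [lap, SimpleGraph.lapMatrix, SimpleGraph.degMatrix, Matrix.sub_apply,
      Matrix.diagonal_apply_ne _ hab, SimpleGraph.adjMatrix_apply]
    split_ifs <;> norm_num
  row_sum_nonneg a := by
    classical
    have hsum := congrFun (G.lapMatrix_mulVec_const_eq_zero (R := ℝ)) a
    simp only [Matrix.mulVec, dotProduct, mul_one, Pi.zero_apply] at hsum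
    exact hsum.ge

lemma energy_nonneg (G : SimpleGraph V) (x : V → ℝ) : 0 ≤ energy G x := by
  simpa [energy] using (isNetworkLaplacian_lap G).posSemidef.dotProduct_mulVec_nonneg x

lemma energy_lapReg (G : SimpleGraph V) (γ : ℝ) (x : V → ℝ) :
    x ⬝ᵥ lapReg G γ *ᵥ x = energy G x + γ * (x ⬝ᵥ x) := by
  rw [lapReg, Matrix.add_mulVec, dotProduct_add, Matrix.smul_mulVec, Matrix.one_mulVec,
    dotProduct_smul, smul_eq_mul, energy]

lemma dotProduct_self_nonneg_real {ι : Type*} [Fintype ι] (x : ι → ℝ) : 0 ≤ x ⬝ᵥ x :=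
  Finset.sum_nonneg fun i _ => mul_self_nonneg (x i)

lemma energy_le_lapReg (G : SimpleGraph V) {γ : ℝ} (hγ : 0 ≤ γ) (x : V → ℝ) :
    energy G x ≤ x ⬝ᵥ lapReg G γ *ᵥ x := by
  rw [energy_lapReg]
  exact le_add_of_nonneg_right (mul_nonneg hγ (dotProduct_self_nonneg_real x))

lemma isNetworkLaplacian_lapReg (G : SimpleGraph V) {γ : ℝ} (hγ : 0 ≤ γ) :
    IsNetworkLaplacian (lapReg G γ) where
  isHermitian := (isNetworkLaplacian_lap G).isHermitian.add
    (Matrix.isHermitian_one.smul (IsSelfAdjoint.all γ))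
  off_diag_nonpos a b hab := by
    simpa [lapReg, hab] using (isNetworkLaplacian_lap G).off_diag_nonpos a b hab
  row_sum_nonneg a := by
    simpa [lapReg, Finset.sum_add_distrib, Matrix.one_apply] using
      add_nonneg ((isNetworkLaplacian_lap G).row_sum_nonneg a) hγ

lemma carriesCurrent_lapReg {γ : ℝ} (hγ : 0 ≤ γ) {u v : V} (h : 0 < γ ∨ G.Reachable u v) :
    CarriesCurrent (lapReg G γ) u v := by
  classical
  refine carriesCurrent_of_forall_ker (isNetworkLaplacian_lapReg G hγ).isHermitian fun z hz => ?_
  have hsum : energy G z + γ * (z ⬝ᵥ z) = 0 := by rw [← energy_lapReg, hz, dotProduct_zero]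
  obtain ⟨henergy, hreg⟩ := (add_eq_zero_iff_of_nonneg (energy_nonneg G z)
    (mul_nonneg hγ (dotProduct_self_nonneg_real z))).1 hsum
  rcases h with hpos | hreach
  · rw [dotProduct_self_eq_zero.1 ((mul_eq_zero.1 hreg).resolve_left hpos.ne')]
    rfl
  · rw [energy, lap, ← Matrix.toLinearMap₂'_apply'] at henergy
    exact (G.lapMatrix_toLinearMap₂'_apply'_eq_zero_iff_forall_reachable z).1 henergy u v hreach

lemma energy_induce_le (G : SimpleGraph V) (C : Set V) [Fintype C] (x : V → ℝ) :
    energy (G.induce C) (fun a => x a) ≤ energy G x := by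
  classical
  have hsubtype {f : V → ℝ} (hf : ∀ a, 0 ≤ f a) : ∑ a : C, f a ≤ ∑ a, f a := by
    have hsub := Finset.sum_le_sum_of_subset_of_nonneg (f := f) (Finset.subset_univ
      (Finset.univ.map (Function.Embedding.subtype (· ∈ C)))) fun a _ _ => hf a
    simpa using hsub
  have hterm (a b : V) : 0 ≤ if G.Adj a b then (x a - x b) ^ 2 else 0 := by positivity
  have htwo : 2 * energy (G.induce C) (fun a => x a) ≤ 2 * energy G x := by
    rw [two_mul_energy, two_mul_energy]
    simp only [SimpleGraph.comap_adj, Function.Embedding.subtype_apply]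
    calc _ ≤ ∑ a : C, ∑ b, (if G.Adj a b then (x a - x b) ^ 2 else 0) :=
          Finset.sum_le_sum fun a _ => hsubtype (hterm a)
      _ ≤ _ := hsubtype fun a => Finset.sum_nonneg fun b _ => hterm a b
  linarith

lemma InducedDiamLE.sq_sub_le {C : Set V} {Δ : ℝ} (h : InducedDiamLE G C Δ) (hΔ : 0 ≤ Δ) {u v : V}
    (hu : u ∈ C) (hv : v ∈ C) (x : V → ℝ) : (x u - x v) ^ 2 ≤ Δ * energy G x := by
  classical
  have huv := h ⟨u, hu⟩ ⟨v, hv⟩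
  have hcurrent := carriesCurrent_of_effRes_ne_top (ne_top_of_le_ne_top ENNReal.ofReal_ne_top huv)
  rw [effRes_eq_ofReal_reff hcurrent, ENNReal.ofReal_le_ofReal_iff hΔ] at huv
  have hsq := sq_sub_le_reff_mul_energy (isNetworkLaplacian_lap (G.induce C)).posSemidef hcurrent
    fun a => x a
  exact hsq.trans (mul_le_mul huv (energy_induce_le G C x) (energy_nonneg _ _) hΔ)

lemma InducedDiamLE.reff_le {C : Set V} {Δ γ : ℝ} (h : InducedDiamLE G C Δ) (hΔ : 0 ≤ Δ)
    (hγ : 0 ≤ γ) {u v : V} (hu : u ∈ C) (hv : v ∈ C) (huv : CarriesCurrent (lapReg G γ) u v) :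
    reff (lapReg G γ) u v ≤ Δ :=
  reff_le_of_forall_sq_sub_le (isNetworkLaplacian_lapReg G hγ).isHermitian huv hΔ fun x =>
    (h.sq_sub_le hΔ hu hv x).trans (mul_le_mul_of_nonneg_left (energy_le_lapReg G hγ x) hΔ)

lemma card_mul_sq_le_two_mul_energy (x : V → ℝ) (J : Finset (V × V))
    (hJ : ∀ e ∈ J, G.Adj e.1 e.2) {h : ℝ} (hlong : ∀ e ∈ J, h ≤ (x e.1 - x e.2) ^ 2) :
    J.card * h ≤ 2 * energy G x := by
  classical
  calc (J.card : ℝ) * h ≤ ∑ e ∈ J, (if G.Adj e.1 e.2 then (x e.1 - x e.2) ^ 2 else 0) := by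
        rw [← nsmul_eq_mul]
        exact Finset.card_nsmul_le_sum _ _ _ fun e he => by
          rw [if_pos (hJ e he)]
          exact hlong e he
    _ ≤ ∑ e : V × V, (if G.Adj e.1 e.2 then (x e.1 - x e.2) ^ 2 else 0) :=
        Finset.sum_le_univ_sum_of_nonneg fun e => by positivity
    _ = 2 * energy G x := by rw [Fintype.sum_prod_type, two_mul_energy]

end Graph

section WeightedGraph

variable {n : ℕ}

lemma bvec_mul_bvec_nonpos {V : Type*} [DecidableEq V] (u v : V) {a b : V} (hab : a ≠ b) :
    bvec u v a * bvec u v b ≤ 0 := by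
  simp only [bvec, Pi.sub_apply, Pi.single_apply]
  split_ifs <;> simp_all

namespace WGraph

lemma laplacian_eq_sum (H : WGraph n) (a b : Fin n) :
    H.laplacian a b = ∑ e, H.w e * (prow e a * prow e b) + H.reg * if a = b then 1 else 0 := by
  simp only [laplacian, Matrix.mul_apply, Matrix.transpose_apply, inc, Matrix.of_apply,
    Fintype.sum_sum_type, Sum.elim_inl, Sum.elim_inr, Pi.smul_apply, smul_eq_mul]
  congr 1
  · refine Finset.sum_congr rfl fun e _ => ?_
    rw [mul_mul_mul_comm, Real.mul_self_sqrt (H.w_nonneg e)]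
  · simp [Pi.single_apply, Real.mul_self_sqrt H.reg_nonneg]

lemma isNetworkLaplacian_laplacian (H : WGraph n) : IsNetworkLaplacian H.laplacian where
  isHermitian := by
    simpa [laplacian] using Matrix.isHermitian_conjTranspose_mul_self H.inc
  off_diag_nonpos a b hab := by
    rw [laplacian_eq_sum, if_neg hab, mul_zero, add_zero]
    exact Finset.sum_nonpos fun e _ =>
      mul_nonpos_of_nonneg_of_nonpos (H.w_nonneg e) (bvec_mul_bvec_nonpos _ _ hab)
  row_sum_nonneg a := by
    have hrow (e : Pairs n) : ∑ b, prow e b = 0 := by simp [prow, bvec]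
    have hedges : ∑ b, ∑ e, H.w e * (prow e a * prow e b) = 0 := by
      rw [Finset.sum_comm]
      simp only [← Finset.mul_sum, hrow, mul_zero, Finset.sum_const_zero]
    simpa [laplacian_eq_sum, Finset.sum_add_distrib, hedges] using H.reg_nonneg

lemma dotProduct_laplacian_mulVec (H : WGraph n) (x y : Fin n → ℝ) :
    x ⬝ᵥ H.laplacian *ᵥ y = (H.inc *ᵥ x) ⬝ᵥ (H.inc *ᵥ y) := by
  rw [laplacian, ← Matrix.mulVec_mulVec, Matrix.dotProduct_mulVec, Matrix.vecMul_transpose]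

end WGraph

end WeightedGraph

section Multigraph

variable {β κ : Type*} [DecidableEq κ]

/-- The edges with both ends in `T`, in the multigraph with edges `J` whose edge `e` joins `s e`
to `t e`. -/
def edgesInside (s t : β → κ) (J : Finset β) (T : Finset κ) : Finset β :=
  J.filter fun e => s e ∈ T ∧ t e ∈ T

/-- The edges with one end in `A` and the other one in `B`. -/
def edgesBetween (s t : β → κ) (J : Finset β) (A B : Finset κ) : Finset β :=
  J.filter fun e => (s e ∈ A ∧ t e ∈ B) ∨ (s e ∈ B ∧ t e ∈ A)

/-- The cut of `T` into `A` and `T \ A` has few edges compared with those inside `A`, which is the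
side that spans at most half of the edges. -/
structure IsSparseCut (s t : β → κ) (J : Finset β) (ε N : ℝ) (T A : Finset κ) : Prop where
  subset : A ⊆ T
  card_edgesBetween_le :
    ((edgesBetween s t J A (T \ A)).card : ℝ) ≤ ε * (edgesInside s t J A).card + N
  two_mul_card_edgesInside_le : 2 * (edgesInside s t J A).card ≤ (edgesInside s t J T).card

variable {s t : β → κ} {J : Finset β}

lemma edgesBetween_comm (A B : Finset κ) : edgesBetween s t J A B = edgesBetween s t J B A :=
  Finset.filter_congr fun _ _ => or_comm

lemma edgesInside_mono {A B : Finset κ} (h : A ⊆ B) :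
    edgesInside s t J A ⊆ edgesInside s t J B :=
  Finset.monotone_filter_right J fun _ _ he => ⟨h he.1, h he.2⟩

lemma card_edgesInside_eq_add {A T : Finset κ} (h : A ⊆ T) :
    (edgesInside s t J T).card = (edgesInside s t J A).card +
      (edgesInside s t J (T \ A)).card + (edgesBetween s t J A (T \ A)).card := by
  classical
  rw [← Finset.card_union_of_disjoint, ← Finset.card_union_of_disjoint]
  · congr 1
    ext e
    have hs := @h (s e)
    have ht := @h (t e)
    simp only [edgesInside, edgesBetween, Finset.mem_union, Finset.mem_filter, Finset.mem_sdiff]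
    tauto
  · rw [Finset.disjoint_left]
    intro e
    simp only [edgesInside, edgesBetween, Finset.mem_union, Finset.mem_filter, Finset.mem_sdiff]
    tauto
  · rw [Finset.disjoint_left]
    intro e
    simp only [edgesInside, Finset.mem_filter, Finset.mem_sdiff]
    tauto

lemma card_edgesBetween_add_card_edgesInside_le {A B : Finset κ} (T : Finset κ) (hAB : A ⊆ B) :
    (edgesBetween s t J A (T \ A)).card + (edgesInside s t J A).card ≤
      (edgesInside s t J B).card + (edgesBetween s t J A (T \ B)).card := by
  classical
  have hsubset : edgesBetween s t J A (T \ A) ⊆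
      edgesBetween s t J A (B \ A) ∪ edgesBetween s t J A (T \ B) := by
    intro e
    have hs := @hAB (s e)
    have ht := @hAB (t e)
    simp only [edgesBetween, Finset.mem_union, Finset.mem_filter, Finset.mem_sdiff]
    tauto
  have hcard := (Finset.card_le_card hsubset).trans (Finset.card_union_le _ _)
  have hinside := card_edgesInside_eq_add (s := s) (t := t) (J := J) hAB
  lia

/-- Region growing: as long as the boundaries are large, the number of edges inside grows by the
factor `1 + ε` in each step. -/
lemma exists_card_edgesBetween_le_of_chain {T : Finset κ} {S : ℕ → Finset κ} {m : ℕ} {N ε : ℝ}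
    (hε : 0 ≤ ε) (hS : ∀ j ≤ m, S j ⊆ S (j + 1))
    (hfar : ∀ j ≤ m, ((edgesBetween s t J (S j) (T \ S (j + 1))).card : ℝ) ≤ N)
    (hpow : ((edgesInside s t J (S (m + 1))).card : ℝ) < (1 + ε) ^ m) :
    ∃ j ≤ m, ((edgesBetween s t J (S j) (T \ S j)).card : ℝ) ≤
      ε * (edgesInside s t J (S j)).card + N := by
  by_contra! hlarge
  let a : ℕ → ℕ := fun j => (edgesInside s t J (S j)).card
  have hstep (j : ℕ) (hj : j ≤ m) : (1 + ε) * (a j : ℝ) < a (j + 1) := by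
    have hgrow : (edgesBetween s t J (S j) (T \ S j)).card + a j ≤
        a (j + 1) + (edgesBetween s t J (S j) (T \ S (j + 1))).card :=
      card_edgesBetween_add_card_edgesInside_le T (hS j hj)
    rify at hgrow
    linarith [hlarge j hj, hfar j hj]
  have hpow_le (j : ℕ) (hj : j ≤ m) : (1 + ε) ^ j ≤ (a (j + 1) : ℝ) := by
    induction j with
    | zero =>
      have hpos : (0 : ℝ) < a (0 + 1) := lt_of_le_of_lt (by positivity) (hstep 0 hj)
      rw [pow_zero]
      exact_mod_cast hpos
    | succ j ih =>
      rw [pow_succ']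
      exact (mul_le_mul_of_nonneg_left (ih (by lia)) (by linarith)).trans (hstep (j + 1) hj).le
  exact (hpow_le m le_rfl).not_gt hpow

lemma exists_isSparseCut_of_chain {T : Finset κ} {S : ℕ → Finset κ} {m : ℕ} {N ε : ℝ}
    (hε : 0 ≤ ε) (hT : ∀ j, S j ⊆ T) (hS : Monotone S)
    (hfar : ∀ j, ((edgesBetween s t J (S j) (T \ S (j + 1))).card : ℝ) ≤ N)
    (hpow : ((edgesInside s t J T).card : ℝ) < (1 + ε) ^ m) :
    ∃ j ≤ 2 * (m + 1), ∃ A, (A = S j ∨ A = T \ S j) ∧ IsSparseCut s t J ε N T A := by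
  have hcard_mono {A B : Finset κ} (h : A ⊆ B) :
      (edgesInside s t J A).card ≤ (edgesInside s t J B).card :=
    Finset.card_le_card (edgesInside_mono h)
  have hpow' {A : Finset κ} (h : A ⊆ T) : ((edgesInside s t J A).card : ℝ) < (1 + ε) ^ m :=
    lt_of_le_of_lt (by exact_mod_cast hcard_mono h) hpow
  have hsplit := card_edgesInside_eq_add (s := s) (t := t) (J := J) (hT (m + 1))
  -- grow from the end of the chain whose half spans fewer edges
  rcases le_total (edgesInside s t J (S (m + 1))).card
    (edgesInside s t J (T \ S (m + 1))).card with hle | hle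
  · obtain ⟨j, hj, hcut⟩ := exists_card_edgesBetween_le_of_chain (S := S) hε
      (fun j _ => hS (Nat.le_succ j)) (fun j _ => hfar j) (hpow' (hT (m + 1)))
    have hhalf := hcard_mono (hS (show j ≤ m + 1 by lia))
    exact ⟨j, by lia, S j, Or.inl rfl, hT j, hcut, by lia⟩
  · set R : ℕ → Finset κ := fun j => T \ S (2 * (m + 1) - j) with hR
    have hfarR (j : ℕ) (hj : j ≤ m) :
        ((edgesBetween s t J (R j) (T \ R (j + 1))).card : ℝ) ≤ N := by
      have hfar' := hfar (2 * (m + 1) - (j + 1))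
      rw [show 2 * (m + 1) - (j + 1) + 1 = 2 * (m + 1) - j by lia] at hfar'
      rwa [hR, Finset.sdiff_sdiff_eq_self (hT _), edgesBetween_comm]
    have hR_le (j : ℕ) : R j ⊆ R (j + 1) :=
      Finset.sdiff_subset_sdiff le_rfl (hS (Nat.sub_le_sub_left j.le_succ _))
    obtain ⟨j, hj, hcut⟩ := exists_card_edgesBetween_le_of_chain hε (fun j _ => hR_le j) hfarR
      (hpow' Finset.sdiff_subset)
    have hhalf := hcard_mono (Finset.sdiff_subset_sdiff (le_refl T)
      (hS (show m + 1 ≤ 2 * (m + 1) - j by lia)))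
    exact ⟨_, by lia, _, Or.inr rfl, Finset.sdiff_subset, hcut, by lia⟩

/-- Cut recursively. Each cut uses up one of the `T.card - 1` possible separations, which accounts
for `N` edges, and each edge is charged `ε` at most `p` times, since the number of edges halves on
the side that is charged. -/
lemma card_edgesInside_le_of_forall_exists_isSparseCut {N ε : ℝ} (hN : 0 ≤ N) (hε : 0 ≤ ε)
    (hcut : ∀ T : Finset κ, (edgesInside s t J T).Nonempty →
      ∃ A, A.Nonempty ∧ A ≠ T ∧ IsSparseCut s t J ε N T A)
    (T : Finset κ) (hT : T.Nonempty) (p : ℕ) (hp : (edgesInside s t J T).card < 2 ^ p) :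
    ((edgesInside s t J T).card : ℝ) ≤
      N * ((T.card : ℝ) - 1) + ε * p * (edgesInside s t J T).card := by
  induction hcard : T.card using Nat.strong_induction_on generalizing T p with
  | _ c ih =>
  subst hcard
  rcases (edgesInside s t J T).eq_empty_or_nonempty with hempty | hne
  · have hT1 : (1 : ℝ) ≤ T.card := by exact_mod_cast hT.card_pos
    simpa [hempty] using mul_nonneg hN (sub_nonneg.2 hT1)
  obtain ⟨A, hA, hAT, hAsub, hbetween, hhalf⟩ := hcut T hne
  have hB : (T \ A).Nonempty := Finset.sdiff_nonempty.2 fun hTA => hAT (hAsub.antisymm hTA)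
  have hcardT := Finset.card_sdiff_add_card_eq_card hAsub
  have hApos := hA.card_pos
  have hBpos := hB.card_pos
  have hsplit := card_edgesInside_eq_add (s := s) (t := t) (J := J) hAsub
  obtain ⟨p, rfl⟩ : ∃ p', p = p' + 1 :=
    Nat.exists_eq_succ_of_ne_zero fun h0 => by simp [h0, hne.ne_empty] at hp
  have hAle := ih A.card (by lia) A hA p (by rw [pow_succ] at hp; lia) rfl
  have hBle := ih (T \ A).card (by lia) (T \ A) hB (p + 1) (by lia) rfl
  have hsplit' : ((edgesInside s t J T).card : ℝ) = (edgesInside s t J A).card +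
      (edgesInside s t J (T \ A)).card + (edgesBetween s t J A (T \ A)).card := by
    exact_mod_cast hsplit
  have hcardT' : ((T \ A).card : ℝ) + A.card = T.card := by exact_mod_cast hcardT
  rw [hsplit', ← hcardT']
  push_cast at hBle ⊢
  have hcharge : 0 ≤ ε * (p + 1) * ((edgesBetween s t J A (T \ A)).card : ℝ) := by positivity
  nlinarith

end Multigraph

section Potential

variable {V κ : Type*}

open Classical in
/-- The clusters in `T` that meet the superlevel set `{v | c ≤ x v}`, for a clustering `cl`. -/
def superlevelClusters (cl : V → κ) (T : Finset κ) (x : V → ℝ) (c : ℝ) : Finset κ :=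
  T.filter fun C => ∃ v, cl v = C ∧ c ≤ x v

variable {cl : V → κ} {T : Finset κ} {x : V → ℝ} {c δ : ℝ}

lemma mem_superlevelClusters {C : κ} :
    C ∈ superlevelClusters cl T x c ↔ C ∈ T ∧ ∃ v, cl v = C ∧ c ≤ x v := by
  classical exact Finset.mem_filter

lemma superlevelClusters_subset : superlevelClusters cl T x c ⊆ T := by
  classical exact Finset.filter_subset _ _

lemma superlevelClusters_antitone : Antitone (superlevelClusters cl T x) := by
  intro c c' hc C hC
  obtain ⟨hCT, v, hv, hxv⟩ := mem_superlevelClusters.1 hC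
  exact mem_superlevelClusters.2 ⟨hCT, v, hv, hc.trans hxv⟩

lemma sub_le_of_mem_superlevelClusters (hvar : ∀ p q, cl p = cl q → |x p - x q| ≤ δ) {v : V}
    (hv : cl v ∈ superlevelClusters cl T x c) : c - δ ≤ x v := by
  obtain ⟨-, w, hw, hxw⟩ := mem_superlevelClusters.1 hv
  linarith [(abs_le.1 (hvar w v hw)).2]

lemma lt_of_mem_sdiff_superlevelClusters [DecidableEq κ] {v : V}
    (hv : cl v ∈ T \ superlevelClusters cl T x c) : x v < c := by
  obtain ⟨hvT, hv⟩ := Finset.mem_sdiff.1 hv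
  by_contra! hcx
  exact hv (mem_superlevelClusters.2 ⟨hvT, v, rfl, hcx⟩)

variable [Fintype V] [DecidableEq V] {G : SimpleGraph V} {J : Finset (V × V)}

/-- The edges counted here pass over a gap of length `δ`, so each costs energy `δ ^ 2`. -/
lemma card_edgesBetween_superlevelClusters_le [DecidableEq κ] (hJ : ∀ e ∈ J, G.Adj e.1 e.2)
    (hvar : ∀ p q, cl p = cl q → |x p - x q| ≤ δ) (hδ : 0 < δ) {E : ℝ} (hx : energy G x ≤ E) :
    ((edgesBetween (cl ·.1) (cl ·.2) J (superlevelClusters cl T x c)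
      (T \ superlevelClusters cl T x (c - 2 * δ))).card : ℝ) ≤ 2 * E / δ ^ 2 := by
  rw [le_div_iff₀ (by positivity)]
  refine (card_mul_sq_le_two_mul_energy x _ (fun e he => hJ e (Finset.mem_filter.1 he).1)
    fun e he => ?_).trans (mul_le_mul_of_nonneg_left hx zero_le_two)
  have hgap {p q : V} (hp : cl p ∈ superlevelClusters cl T x c)
      (hq : cl q ∈ T \ superlevelClusters cl T x (c - 2 * δ)) : δ ^ 2 ≤ (x p - x q) ^ 2 := by
    refine pow_le_pow_left₀ hδ.le ?_ 2
    linarith [sub_le_of_mem_superlevelClusters hvar hp, lt_of_mem_sdiff_superlevelClusters hq]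
  rcases (Finset.mem_filter.1 he).2 with ⟨hp, hq⟩ | ⟨hq, hp⟩
  · exact hgap hp hq
  · rw [← neg_sub, neg_sq]
    exact hgap hp hq

lemma exists_isSparseCut_of_potential [DecidableEq κ] (hJ : ∀ e ∈ J, G.Adj e.1 e.2)
    (hvar : ∀ p q, cl p = cl q → |x p - x q| ≤ δ) (hδ : 0 < δ) {E : ℝ} (hx : energy G x ≤ E)
    {a b : V} (hab : x a - x b = 1) (ha : cl a ∈ T) (hb : cl b ∈ T) {m : ℕ}
    (hmδ : (4 * m + 5) * δ < 1) {ε : ℝ} (hε : 0 ≤ ε) (hpow : (J.card : ℝ) < (1 + ε) ^ m) :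
    ∃ A, A.Nonempty ∧ A ≠ T ∧ IsSparseCut (cl ·.1) (cl ·.2) J ε (2 * E / δ ^ 2) T A := by
  set S : ℕ → Finset κ := fun j => superlevelClusters cl T x (x a - 2 * δ * j) with hS
  have hmono : Monotone S := fun i j hij => superlevelClusters_antitone (by
    have : (i : ℝ) ≤ j := Nat.cast_le.2 hij
    gcongr)
  have hfar (j : ℕ) : ((edgesBetween (cl ·.1) (cl ·.2) J (S j) (T \ S (j + 1))).card : ℝ) ≤
      2 * E / δ ^ 2 := by
    have hstep : S (j + 1) = superlevelClusters cl T x (x a - 2 * δ * j - 2 * δ) := by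
      rw [hS]
      push_cast
      ring_nf
    rw [hstep]
    exact card_edgesBetween_superlevelClusters_le hJ hvar hδ hx
  have hinside : ((edgesInside (cl ·.1) (cl ·.2) J T).card : ℝ) < (1 + ε) ^ m :=
    lt_of_le_of_lt (by exact_mod_cast Finset.card_filter_le _ _) hpow
  obtain ⟨j, hj, A, hA, hcut⟩ := exists_isSparseCut_of_chain hε
    (fun _ => superlevelClusters_subset) hmono hfar hinside
  have haS : cl a ∈ S j := mem_superlevelClusters.2
    ⟨ha, a, rfl, sub_le_self _ (mul_nonneg (by positivity) j.cast_nonneg)⟩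
  have hbS : cl b ∉ S j := fun hmem => by
    have hbx := sub_le_of_mem_superlevelClusters hvar hmem
    have hj' : (j : ℝ) ≤ 2 * (m + 1) := by exact_mod_cast hj
    nlinarith [mul_le_mul_of_nonneg_left hj' hδ.le]
  refine ⟨A, ?_, ?_, hcut⟩ <;> rcases hA with rfl | rfl
  · exact ⟨cl a, haS⟩
  · exact ⟨cl b, Finset.mem_sdiff.2 ⟨hb, hbS⟩⟩
  · exact (ne_of_mem_of_not_mem' hb hbS).symm
  · exact (ne_of_mem_of_not_mem' ha fun hmem => (Finset.mem_sdiff.1 hmem).2 haS).symm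

lemma two_pow_le_one_add_inv_pow {g : ℕ} (hg : 1 ≤ g) :
    (2 : ℝ) ^ (2 * g) ≤ (1 + 1 / (4 * (g : ℝ))) ^ (8 * g ^ 2) := by
  have : (0 : ℝ) < g := Nat.cast_pos.2 hg
  have hbernoulli := one_add_mul_le_pow (a := 1 / (4 * (g : ℝ)))
    (by linarith [show 0 ≤ 1 / (4 * (g : ℝ)) by positivity]) (4 * g)
  have htwo : (1 : ℝ) + (4 * g : ℕ) * (1 / (4 * g)) = 2 := by
    push_cast
    field_simp
    norm_num
  rw [show 8 * g ^ 2 = 4 * g * (2 * g) by ring, pow_mul _ (4 * g)]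
  exact pow_le_pow_left₀ zero_le_two (htwo ▸ hbernoulli) _

lemma card_le_of_forall_exists_potential [Fintype κ] (hJ : ∀ e ∈ J, G.Adj e.1 e.2) {g : ℕ}
    (hg : 1 ≤ g) (hcard : J.card < 2 ^ (2 * g)) {δ E : ℝ} (hδ : 0 < δ)
    (hgδ : (32 * g ^ 2 + 5) * δ < 1) (hE : 0 ≤ E)
    (hpot : ∀ e ∈ J, ∃ x : V → ℝ, x e.1 - x e.2 = 1 ∧ energy G x ≤ E ∧
      ∀ p q, cl p = cl q → |x p - x q| ≤ δ) :
    (J.card : ℝ) ≤ 4 * E / δ ^ 2 * Fintype.card κ := by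
  classical
  have : (0 : ℝ) < g := Nat.cast_pos.2 hg
  have hpow : (J.card : ℝ) < (1 + 1 / (4 * (g : ℝ))) ^ (8 * g ^ 2) :=
    lt_of_lt_of_le (by exact_mod_cast hcard) (two_pow_le_one_add_inv_pow hg)
  have hmδ : (4 * (8 * g ^ 2 : ℕ) + 5) * δ < 1 := by
    push_cast
    linarith
  have hinside : edgesInside (fun e : V × V => cl e.1) (cl ·.2) J Finset.univ = J := by
    simp [edgesInside]
  have hcut (T : Finset κ) (hT : (edgesInside (fun e : V × V => cl e.1) (cl ·.2) J T).Nonempty) :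
      ∃ A, A.Nonempty ∧ A ≠ T ∧
        IsSparseCut (fun e : V × V => cl e.1) (cl ·.2) J (1 / (4 * (g : ℝ))) (2 * E / δ ^ 2) T A :=
      by
    obtain ⟨e, he⟩ := hT
    obtain ⟨heJ, hsT, htT⟩ := Finset.mem_filter.1 he
    obtain ⟨x, hdrop, hx, hvar⟩ := hpot e heJ
    exact exists_isSparseCut_of_potential hJ hvar hδ hx hdrop hsT htT hmδ (by positivity) hpow
  rcases J.eq_empty_or_nonempty with rfl | ⟨e, -⟩
  · simp only [Finset.card_empty, Nat.cast_zero]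
    positivity
  have hle := card_edgesInside_le_of_forall_exists_isSparseCut (by positivity) (by positivity) hcut
    Finset.univ ⟨cl e.1, Finset.mem_univ _⟩ (2 * g) (by rwa [hinside])
  rw [hinside, Finset.card_univ] at hle
  have hhalf : 1 / (4 * (g : ℝ)) * (2 * g : ℕ) * J.card = J.card / 2 := by
    push_cast
    field_simp
    norm_num
  have hN : 0 ≤ 2 * E / δ ^ 2 := by positivity
  linear_combination 2 * hle + 2 * hhalf + 2 * hN

end Potential

lemma sum_le_mul_harmonic {β : Type*} (J : Finset β) (f : β → ℝ) {N : ℝ}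
    (hf : ∀ e ∈ J, 0 ≤ f e)
    (hN : ∀ e ∈ J, ((J.filter fun e' => f e ≤ f e').card : ℝ) * f e ≤ N) :
    ∑ e ∈ J, f e ≤ N * harmonic J.card := by
  classical
  induction hm : J.card generalizing J with
  | zero => simp [Finset.card_eq_zero.1 hm]
  | succ m ih =>
    obtain ⟨e, he, hmin⟩ := Finset.exists_min_image J f (Finset.card_pos.1 (by lia))
    have hfirst : f e ≤ N * ((m : ℝ) + 1)⁻¹ := by
      have hNe := hN e he
      rw [Finset.filter_true_of_mem hmin, hm] at hNe
      rw [← div_eq_mul_inv, le_div_iff₀ (by positivity)]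
      push_cast at hNe
      linarith
    have hrest : ∑ e ∈ J.erase e, f e ≤ N * harmonic m := by
      refine ih (J.erase e) (fun e' he' => hf e' (Finset.mem_of_mem_erase he')) (fun e' he' => ?_)
        (by rw [Finset.card_erase_of_mem he, hm, Nat.add_sub_cancel])
      have he'J := Finset.mem_of_mem_erase he'
      refine (mul_le_mul_of_nonneg_right ?_ (hf e' he'J)).trans (hN e' he'J)
      exact_mod_cast Finset.card_le_card (Finset.filter_subset_filter _ (Finset.erase_subset _ _))
    rw [← Finset.add_sum_erase J f he, harmonic_succ]
    push_cast
    linarith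

lemma harmonic_le_three_mul {m g : ℕ} (hg : 1 ≤ g) (hm : m < 2 ^ (2 * g)) :
    (harmonic m : ℝ) ≤ 3 * g := by
  have hg1 : (1 : ℝ) ≤ g := Nat.one_le_cast.2 hg
  have hlog : Real.log m ≤ 2 * g := by
    rcases Nat.eq_zero_or_pos m with rfl | hm0
    · simp
    · have hmono : Real.log m ≤ Real.log (2 ^ (2 * g)) :=
        Real.log_le_log (Nat.cast_pos.2 hm0) (by exact_mod_cast hm.le)
      rw [Real.log_pow] at hmono
      push_cast at hmono
      nlinarith [Real.log_two_lt_d9]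
  linarith [harmonic_le_one_add_log m]

section HeavyPairs

variable {V κ : Type*} [Fintype V]

open Classical in
/-- The ordered pairs of adjacent vertices at distance at least `θ` with respect to `R`. -/
def heavyPairs (G : SimpleGraph V) (R : V → V → ℝ) (θ : ℝ) : Finset (V × V) :=
  Finset.univ.filter fun e => G.Adj e.1 e.2 ∧ θ ≤ R e.1 e.2

lemma mem_heavyPairs {G : SimpleGraph V} {R : V → V → ℝ} {θ : ℝ} {e : V × V} :
    e ∈ heavyPairs G R θ ↔ G.Adj e.1 e.2 ∧ θ ≤ R e.1 e.2 := by
  classical exact Finset.mem_filter_univ e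

variable [DecidableEq V] {G : SimpleGraph V} {cl : V → κ} {γ Δ : ℝ}

lemma exists_unit_potential_of_le_reff (hγ : 0 ≤ γ)
    (hdiam : ∀ i, InducedDiamLE G {v | cl v = i} Δ) (hΔ : 0 ≤ Δ) {δ R : ℝ} (hδ : 0 ≤ δ)
    (hR : 0 < R) (hΔR : Δ ≤ δ ^ 2 * R) {u v : V} (huv : CarriesCurrent (lapReg G γ) u v)
    (hle : R ≤ reff (lapReg G γ) u v) :
    ∃ x : V → ℝ, x u - x v = 1 ∧ energy G x ≤ R⁻¹ ∧
      ∀ p q, cl p = cl q → |x p - x q| ≤ δ := by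
  obtain ⟨x, hdrop, hx⟩ := exists_unit_potential (isNetworkLaplacian_lapReg G hγ).isHermitian huv
    (hR.trans_le hle).ne'
  have henergy : energy G x ≤ R⁻¹ :=
    (energy_le_lapReg G hγ x).trans (hx.le.trans (inv_anti₀ hR hle))
  refine ⟨x, hdrop, henergy, fun p q hpq => abs_le_of_sq_le_sq ?_ hδ⟩
  calc (x p - x q) ^ 2 ≤ Δ * energy G x := (hdiam (cl q)).sq_sub_le hΔ hpq rfl x
    _ ≤ Δ * R⁻¹ := mul_le_mul_of_nonneg_left henergy hΔ
    _ ≤ δ ^ 2 := by rwa [← div_eq_mul_inv, div_le_iff₀ hR]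

/-- For every `R` above the threshold at most `4 / (δ ^ 2 * R)` pairs per cluster have resistance
at least `R`; the sum over all scales `R` costs a logarithm. -/
lemma sum_heavyPairs_reff_le [Fintype κ] (hγ : 0 ≤ γ)
    (hcurrent : ∀ u v, CarriesCurrent (lapReg G γ) u v)
    (hdiam : ∀ i, InducedDiamLE G {v | cl v = i} Δ) (hΔ : 0 < Δ) {g : ℕ} (hg : 1 ≤ g)
    (hV : Fintype.card V < 2 ^ g) {δ : ℝ} (hδ : 0 < δ) (hgδ : (32 * g ^ 2 + 5) * δ < 1) :
    ∑ e ∈ heavyPairs G (reff (lapReg G γ)) (Δ / δ ^ 2), reff (lapReg G γ) e.1 e.2 ≤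
      4 / δ ^ 2 * Fintype.card κ * (3 * g) := by
  classical
  set R := reff (lapReg G γ)
  set J := heavyPairs G R (Δ / δ ^ 2)
  have hcard : J.card < 2 ^ (2 * g) := by
    rw [two_mul, pow_add]
    exact (Finset.card_le_univ J).trans_lt (Fintype.card_prod V V ▸ Nat.mul_lt_mul'' hV hV)
  have hpos {e : V × V} (he : e ∈ J) : 0 < R e.1 e.2 :=
    (div_pos hΔ (by positivity)).trans_le (mem_heavyPairs.1 he).2
  have hweak (e : V × V) (he : e ∈ J) :
      ((J.filter fun e' => R e.1 e.2 ≤ R e'.1 e'.2).card : ℝ) * R e.1 e.2 ≤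
        4 / δ ^ 2 * Fintype.card κ := by
    have hRe := hpos he
    have hΔR : Δ ≤ δ ^ 2 * R e.1 e.2 := (div_le_iff₀' (by positivity)).1 (mem_heavyPairs.1 he).2
    have hcount := card_le_of_forall_exists_potential (G := G) (cl := cl)
      (J := J.filter fun e' => R e.1 e.2 ≤ R e'.1 e'.2)
      (fun e' he' => (mem_heavyPairs.1 (Finset.mem_filter.1 he').1).1) hg
      ((Finset.card_filter_le _ _).trans_lt hcard) hδ hgδ (inv_nonneg.2 hRe.le) fun e' he' =>
        exists_unit_potential_of_le_reff hγ hdiam hΔ.le hδ.le hRe hΔR (hcurrent _ _)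
          (Finset.mem_filter.1 he').2
    rw [← le_div_iff₀ hRe]
    exact hcount.trans_eq (by ring)
  calc ∑ e ∈ J, R e.1 e.2 ≤ 4 / δ ^ 2 * Fintype.card κ * harmonic J.card :=
        sum_le_mul_harmonic J (fun e => R e.1 e.2) (fun e he => (hpos he).le) hweak
    _ ≤ _ := mul_le_mul_of_nonneg_left (harmonic_le_three_mul hg hcard) (by positivity)

/-- The effective resistances of a network in which every pair of vertices can exchange current
form a pseudometric. -/
abbrev resistanceMetric {L : Matrix V V ℝ} (hL : IsNetworkLaplacian L)
    (hcurrent : ∀ u v, CarriesCurrent L u v) : PseudoMetricSpace V where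
  dist := reff L
  dist_self := reff_self L
  dist_comm := reff_comm L
  dist_triangle u v w := reff_triangle hL (hcurrent u v) (hcurrent v w)

end HeavyPairs

lemma card_le_of_forall_mul_mem_Icc (s : Finset ℕ) {a b θ : ℝ} (hθ : 0 < θ) (hab : a ≤ b)
    (hs : ∀ j ∈ s, j * θ ∈ Set.Icc a b) : (s.card : ℝ) ≤ (b - a) / θ + 1 := by
  rcases s.eq_empty_or_nonempty with rfl | hne
  · simpa using add_nonneg (div_nonneg (sub_nonneg.2 hab) hθ.le) zero_le_one
  · have hsub : s ⊆ Finset.Icc (s.min' hne) (s.max' hne) := fun j hj =>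
      Finset.mem_Icc.2 ⟨s.min'_le j hj, s.le_max' j hj⟩
    have hcard : s.card + s.min' hne ≤ s.max' hne + 1 := by
      have hle := Finset.card_le_card hsub
      rw [Nat.card_Icc] at hle
      have := s.min'_le _ (s.max'_mem hne)
      lia
    have hdiff : (s.max' hne : ℝ) - s.min' hne ≤ (b - a) / θ := by
      rw [le_div_iff₀ hθ, sub_mul]
      linarith [(hs _ (s.min'_mem hne)).1, (hs _ (s.max'_mem hne)).2]
    rify at hcard
    linarith

open Classical in
lemma edgeConn_le_card_interedges {V : Type*} [Fintype V] [DecidableEq V] (G : SimpleGraph V)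
    {u v : V} {S : Finset V} (hu : u ∈ S) (hv : v ∉ S) :
    edgeConn G u v ≤ (G.interedges S Sᶜ).card :=
  Nat.sInf_le ⟨S, hu, hv, rfl⟩

section Balls

variable {V κ : Type*} [PseudoMetricSpace V]

/-- No vertex lies at distance between `t` and `t + θ` from `u`, so that every edge leaving the
ball of radius `t` is long. -/
def IsClearRadius (u : V) (θ t : ℝ) : Prop := ∀ w, t < dist u w → t + θ < dist u w

lemma dist_sub_dist_le (u p q : V) : dist u q - dist u p ≤ dist p q := by
  linarith [dist_triangle u p q]

open Classical in
lemma card_crossed_radii_le (s : Finset ℕ) {θ : ℝ} (hθ : 0 < θ) (u : V) {p q : V}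
    (hpq : θ ≤ dist p q) :
    ((s.filter fun j : ℕ => dist u p ≤ j * θ ∧ j * θ ≤ dist u q).card : ℝ) * θ ≤
      2 * dist p q := by
  by_cases hup : dist u p ≤ dist u q
  · have hcard := card_le_of_forall_mul_mem_Icc _ hθ hup fun j hj =>
      (Finset.mem_filter (s := s)
        (p := fun j : ℕ => dist u p ≤ j * θ ∧ j * θ ≤ dist u q)).1 hj |>.2
    have hmul := mul_le_mul_of_nonneg_right hcard hθ.le
    rw [add_mul, div_mul_cancel₀ _ hθ.ne', one_mul] at hmul
    linarith [dist_sub_dist_le u p q]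
  · rw [Finset.filter_false_of_mem fun j _ hj => hup (hj.1.trans hj.2), Finset.card_empty,
      Nat.cast_zero, zero_mul]
    exact mul_nonneg zero_le_two dist_nonneg

open Classical in
/-- The clusters that meet the closed ball of radius `ρ` around `u`. -/
def clustersNear [Fintype κ] (cl : V → κ) (ρ : ℝ) (u : V) : Finset κ :=
  Finset.univ.filter fun C => ∃ w, cl w = C ∧ dist u w ≤ ρ

lemma mem_clustersNear [Fintype κ] {cl : V → κ} {ρ : ℝ} {u : V} {C : κ} :
    C ∈ clustersNear cl ρ u ↔ ∃ w, cl w = C ∧ dist u w ≤ ρ := by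
  classical exact Finset.mem_filter_univ C

open Classical in
lemma card_not_isClearRadius_le [Fintype κ] {cl : V → κ} {θ ρ : ℝ} (hθ : 0 < θ)
    (hcl : ∀ v w, cl v = cl w → dist v w ≤ θ) (u : V) (s : Finset ℕ)
    (hs : ∀ j ∈ s, j * θ + θ ≤ ρ) :
    (s.filter fun j : ℕ => ¬ IsClearRadius u θ (j * θ)).card ≤
      4 * (clustersNear cl ρ u).card := by
  let spoiledBy (C : κ) : Finset ℕ :=
    s.filter fun j => ∃ w, cl w = C ∧ j * θ < dist u w ∧ dist u w ≤ j * θ + θ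
  have hsub : (s.filter fun j : ℕ => ¬ IsClearRadius u θ (j * θ)) ⊆
      (clustersNear cl ρ u).biUnion spoiledBy := by
    intro j hj
    obtain ⟨hjs, hclear⟩ := Finset.mem_filter.1 hj
    obtain ⟨w, hw⟩ : ∃ w, j * θ < dist u w ∧ dist u w ≤ j * θ + θ := by
      simpa only [IsClearRadius, not_forall, not_lt, exists_prop] using hclear
    exact Finset.mem_biUnion.2 ⟨cl w, mem_clustersNear.2 ⟨w, rfl, hw.2.trans (hs j hjs)⟩,
      Finset.mem_filter.2 ⟨hjs, w, rfl, hw⟩⟩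
  refine (Finset.card_le_card hsub).trans
    ((Finset.card_biUnion_le_card_mul _ _ 4 fun C hC => ?_).trans_eq (mul_comm _ _))
  obtain ⟨v, rfl, -⟩ := mem_clustersNear.1 hC
  have hfour : (dist u v + θ - (dist u v - 2 * θ)) / θ + 1 = 4 := by
    field_simp
    ring
  have hcard := card_le_of_forall_mul_mem_Icc (spoiledBy (cl v)) (a := dist u v - 2 * θ)
    (b := dist u v + θ) hθ (by linarith) fun j hj => by
      obtain ⟨w, hw, hlt, hle⟩ := (Finset.mem_filter.1 hj).2
      have hdist := hcl w v hw
      constructor <;> linarith [dist_sub_dist_le u w v, dist_sub_dist_le u v w, dist_comm w v]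
  rw [hfour] at hcard
  exact_mod_cast hcard

lemma sum_card_clustersNear_le [Fintype κ] {cl : V → κ} {ρ Δ : ℝ}
    (hcl : ∀ v w, cl v = cl w → dist v w ≤ Δ) {U : Finset V}
    (hU : ∀ u ∈ U, ∀ v ∈ U, u ≠ v → 2 * ρ + Δ < dist u v) :
    ∑ u ∈ U, (clustersNear cl ρ u).card ≤ Fintype.card κ := by
  classical
  rw [← Finset.card_biUnion]
  · exact Finset.card_le_univ _
  · intro u hu v hv hne
    refine Finset.disjoint_left.2 fun C hC hC' => (hU u hu v hv hne).not_ge ?_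
    obtain ⟨w, rfl, hw⟩ := mem_clustersNear.1 hC
    obtain ⟨w', hw', hvw'⟩ := mem_clustersNear.1 hC'
    linarith [dist_triangle4 u w w' v, hcl w w' hw'.symm, dist_comm w' v]

lemma card_mul_le_card_of_many_clusters [Fintype κ] {cl : V → κ} {Δ θ ρ : ℝ}
    (hcl : ∀ v w, cl v = cl w → dist v w ≤ Δ) {U : Finset V}
    (hU : ∀ u ∈ U, ∀ v ∈ U, u ≠ v → 4 * ρ + Δ < dist u v)
    (hmany : ∀ u ∈ U, ρ / θ ≤ 8 * ((clustersNear cl (2 * ρ) u).card : ℝ)) :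
    U.card * (ρ / θ) ≤ 8 * Fintype.card κ := by
  have hcard : ∑ u ∈ U, (clustersNear cl (2 * ρ) u).card ≤ Fintype.card κ :=
    sum_card_clustersNear_le hcl fun u hu v hv hne => by linarith [hU u hu v hv hne]
  calc U.card * (ρ / θ) = ∑ _u ∈ U, ρ / θ := by rw [Finset.sum_const, nsmul_eq_mul]
    _ ≤ ∑ u ∈ U, 8 * ((clustersNear cl (2 * ρ) u).card : ℝ) := Finset.sum_le_sum hmany
    _ ≤ 8 * Fintype.card κ := by
        rw [← Finset.mul_sum]
        exact mul_le_mul_of_nonneg_left (mod_cast hcard) (by norm_num)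

variable [Fintype V]

open Classical in
lemma IsClearRadius.interedges_subset {u : V} {θ t : ℝ} (h : IsClearRadius u θ t)
    (G : SimpleGraph V) :
    G.interedges (Finset.univ.filter fun w => dist u w ≤ t)
        (Finset.univ.filter fun w => dist u w ≤ t)ᶜ ⊆
      (heavyPairs G dist θ).filter fun e => dist u e.1 ≤ t ∧ t ≤ dist u e.2 := by
  intro e he
  obtain ⟨hin, hout, hadj⟩ := G.mem_interedges_iff.1 he
  simp only [Finset.mem_compl, Finset.mem_filter_univ, not_le] at hin hout
  have hheavy : θ ≤ dist e.1 e.2 := by linarith [h e.2 hout, dist_sub_dist_le u e.1 e.2]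
  exact Finset.mem_filter.2 ⟨mem_heavyPairs.2 ⟨hadj, hheavy⟩, hin, hout.le⟩

variable [DecidableEq V]

lemma card_mul_edgeConn_mul_le (G : SimpleGraph V) {u v : V} {θ ρ : ℝ} (hθ : 0 < θ)
    (hρ : ρ < dist u v) (s : Finset ℕ) (hs : ∀ j ∈ s, j * θ ≤ ρ)
    (hclear : ∀ j ∈ s, IsClearRadius u θ (j * θ)) :
    s.card * edgeConn G u v * θ ≤
      2 * ∑ e ∈ (heavyPairs G dist θ).filter (fun e => dist u e.1 ≤ ρ), dist e.1 e.2 := by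
  classical
  set J := (heavyPairs G dist θ).filter (fun e => dist u e.1 ≤ ρ)
  let Crosses (j : ℕ) (e : V × V) : Prop := dist u e.1 ≤ j * θ ∧ j * θ ≤ dist u e.2
  have hcut (j : ℕ) (hj : j ∈ s) : edgeConn G u v ≤ (J.filter (Crosses j)).card := by
    refine (edgeConn_le_card_interedges G (S := Finset.univ.filter fun w => dist u w ≤ j * θ)
      ?_ ?_).trans (Finset.card_le_card fun e he => ?_)
    · rw [Finset.mem_filter_univ, dist_self]
      positivity
    · rw [Finset.mem_filter_univ, not_le]
      exact (hs j hj).trans_lt hρ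
    · obtain ⟨he, hle⟩ := Finset.mem_filter.1 ((hclear j hj).interedges_subset G (by convert he))
      exact Finset.mem_filter.2 ⟨Finset.mem_filter.2 ⟨he, hle.1.trans (hs j hj)⟩, hle⟩
  have hcount : s.card * edgeConn G u v ≤ ∑ e ∈ J, (s.filter fun j => Crosses j e).card :=
    calc s.card * edgeConn G u v = ∑ _j ∈ s, edgeConn G u v := by
          rw [Finset.sum_const, smul_eq_mul]
      _ ≤ ∑ j ∈ s, (J.filter (Crosses j)).card := Finset.sum_le_sum hcut
      _ = _ := Finset.sum_card_bipartiteAbove_eq_sum_card_bipartiteBelow Crosses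
  calc (s.card * edgeConn G u v : ℝ) * θ
      ≤ (∑ e ∈ J, (s.filter fun j => Crosses j e).card : ℕ) * θ :=
        mul_le_mul_of_nonneg_right (mod_cast hcount) hθ.le
    _ = ∑ e ∈ J, ((s.filter fun j => Crosses j e).card : ℝ) * θ := by
        rw [Nat.cast_sum, Finset.sum_mul]
    _ ≤ ∑ e ∈ J, 2 * dist e.1 e.2 := Finset.sum_le_sum fun e he => by
        convert card_crossed_radii_le s hθ u (mem_heavyPairs.1 (Finset.mem_filter.1 he).1).2
    _ = _ := (Finset.mul_sum ..).symm

lemma edgeConn_mul_le_sum_heavyPairs [Fintype κ] (G : SimpleGraph V) {cl : V → κ} {θ ρ : ℝ}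
    (hcl : ∀ v w, cl v = cl w → dist v w ≤ θ) (hθ : 0 < θ) {u v : V} (hv : ρ < dist u v)
    (hρ : 0 ≤ ρ) (hfew : 8 * ((clustersNear cl (2 * ρ) u).card : ℝ) < ρ / θ) :
    edgeConn G u v * ρ / 8 ≤
      ∑ e ∈ (heavyPairs G dist θ).filter (fun e => dist u e.1 ≤ ρ), dist e.1 e.2 := by
  classical
  set m := (clustersNear cl (2 * ρ) u).card
  set N := ⌊ρ / θ⌋₊
  have hm : 1 ≤ m := Finset.card_pos.2 ⟨cl u, mem_clustersNear.2 ⟨u, rfl, by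
    rw [dist_self]
    positivity⟩⟩
  have hlt : ρ / θ < N + 1 := Nat.lt_floor_add_one _
  have hNθ : N * θ ≤ ρ := (le_div_iff₀ hθ).1 (Nat.floor_le (by positivity))
  have hmN : 8 * m ≤ N := Nat.lt_succ_iff.1 (mod_cast hfew.trans hlt)
  have hρN : ρ ≤ 2 * (N * θ) := by
    have hone : (1 : ℝ) ≤ N := by exact_mod_cast (by lia : 1 ≤ N)
    rw [div_lt_iff₀ hθ] at hlt
    nlinarith
  have hrange (j : ℕ) (hj : j ∈ Finset.Icc 1 N) : j * θ ≤ ρ :=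
    (mul_le_mul_of_nonneg_right (mod_cast (Finset.mem_Icc.1 hj).2) hθ.le).trans hNθ
  have hθρ : θ ≤ ρ := by simpa using hrange 1 (Finset.mem_Icc.2 ⟨le_rfl, by lia⟩)
  set clear := (Finset.Icc 1 N).filter fun j : ℕ => IsClearRadius u θ (j * θ)
  have hclear : (N : ℝ) ≤ 2 * clear.card := by
    have hspoiled := card_not_isClearRadius_le (ρ := 2 * ρ) hθ hcl u (Finset.Icc 1 N)
      fun j hj => by linarith [hrange j hj]
    have hsplit := Finset.card_filter_add_card_filter_not (s := Finset.Icc 1 N)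
      fun j : ℕ => IsClearRadius u θ (j * θ)
    rw [Nat.card_Icc] at hsplit
    exact_mod_cast (by lia : N ≤ 2 * clear.card)
  have hcuts := card_mul_edgeConn_mul_le G hθ hv clear
    (fun j hj => hrange j (Finset.mem_filter.1 hj).1) fun j hj => (Finset.mem_filter.1 hj).2
  have hN := mul_le_mul_of_nonneg_right hclear
    (mul_nonneg (Nat.cast_nonneg (edgeConn G u v)) hθ.le)
  have hρ' := mul_le_mul_of_nonneg_left hρN (Nat.cast_nonneg (edgeConn G u v))
  linarith

lemma card_mul_le_sum_heavyPairs_of_few_clusters [Fintype κ] (G : SimpleGraph V) {cl : V → κ}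
    {θ ρ d : ℝ} (hcl : ∀ v w, cl v = cl w → dist v w ≤ θ) (hθ : 0 < θ) (hρ : 0 ≤ ρ) {U : Finset V}
    (hU : ∀ u ∈ U, ∀ v ∈ U, u ≠ v → 2 * ρ < dist u v)
    (hfew : ∀ u ∈ U, 8 * ((clustersNear cl (2 * ρ) u).card : ℝ) < ρ / θ)
    (hconn : ∀ u ∈ U, ∃ v, ρ < dist u v ∧ d ≤ edgeConn G u v) :
    U.card * (d * ρ / 8) ≤ ∑ e ∈ heavyPairs G dist θ, dist e.1 e.2 := by
  classical
  let J (u : V) : Finset (V × V) := (heavyPairs G dist θ).filter fun e => dist u e.1 ≤ ρ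
  have hdisj : (U : Set V).PairwiseDisjoint J := by
    intro u hu v hv hne
    refine Finset.disjoint_left.2 fun e he he' => ?_
    linarith [hU u hu v hv hne, (Finset.mem_filter.1 he).2, (Finset.mem_filter.1 he').2,
      dist_triangle_right u v e.1, dist_comm e.1 v]
  calc U.card * (d * ρ / 8) = ∑ _u ∈ U, d * ρ / 8 := by rw [Finset.sum_const, nsmul_eq_mul]
    _ ≤ ∑ u ∈ U, ∑ e ∈ J u, dist e.1 e.2 := Finset.sum_le_sum fun u hu => by
        obtain ⟨v, hv, hdv⟩ := hconn u hu
        refine le_trans ?_ (edgeConn_mul_le_sum_heavyPairs G hcl hθ hv hρ (hfew u hu))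
        gcongr
    _ = ∑ e ∈ U.biUnion J, dist e.1 e.2 := (Finset.sum_biUnion hdisj).symm
    _ ≤ _ := Finset.sum_le_sum_of_subset_of_nonneg
        (Finset.biUnion_subset.2 fun u _ => Finset.filter_subset ..) fun _ _ _ => dist_nonneg

/-- A centre whose ball meets many clusters uses up clusters; around any other centre the disjoint
balls collect long edges. -/
lemma card_le_of_separated [Fintype κ] (G : SimpleGraph V) {cl : V → κ} {Δ θ ρ d X : ℝ}
    (hcl : ∀ v w, cl v = cl w → dist v w ≤ Δ) (hΔρ : Δ ≤ 4 * ρ) (hΔθ : Δ ≤ θ) (hθ : 0 < θ)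
    (hρ : 0 < ρ) (hd : 0 < d) (hX : ∑ e ∈ heavyPairs G dist θ, dist e.1 e.2 ≤ X) (U : Finset V)
    (hU : ∀ u ∈ U, ∀ v ∈ U, u ≠ v → 8 * ρ < dist u v)
    (hconn : ∀ u ∈ U, ∃ v, ρ < dist u v ∧ d ≤ edgeConn G u v) :
    (U.card : ℝ) ≤ 8 * (Fintype.card κ * θ / ρ + X / (d * ρ)) := by
  classical
  let Few (u : V) : Prop := 8 * ((clustersNear cl (2 * ρ) u).card : ℝ) < ρ / θ
  have hfew : (U.filter Few).card * (d * ρ / 8) ≤ X :=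
    hX.trans' (card_mul_le_sum_heavyPairs_of_few_clusters G (fun v w h => (hcl v w h).trans hΔθ) hθ
      hρ.le
      (fun u hu v hv hne => by
        linarith [hU u (Finset.mem_filter.1 hu).1 v (Finset.mem_filter.1 hv).1 hne])
      (fun u hu => (Finset.mem_filter.1 hu).2) fun u hu => hconn u (Finset.mem_filter.1 hu).1)
  have hmany : (U.filter fun u => ¬ Few u).card * (ρ / θ) ≤ 8 * Fintype.card κ :=
    card_mul_le_card_of_many_clusters hcl
      (fun u hu v hv hne => by
        linarith [hU u (Finset.mem_filter.1 hu).1 v (Finset.mem_filter.1 hv).1 hne])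
      fun u hu => not_lt.1 (Finset.mem_filter.1 hu).2
  have hsplit : (U.card : ℝ) = (U.filter fun u => ¬ Few u).card + (U.filter Few).card := by
    rw [add_comm]
    exact_mod_cast (Finset.card_filter_add_card_filter_not Few).symm
  rw [← le_div_iff₀ (by positivity)] at hfew hmany
  calc (U.card : ℝ) ≤ 8 * Fintype.card κ / (ρ / θ) + X / (d * ρ / 8) := by
        rw [hsplit]
        gcongr
    _ = _ := by field_simp

end Balls

section Signs

open MeasureTheory ProbabilityTheory
open scoped BigOperators

lemma expect_prod_apply {ι Ω : Type*} [Fintype ι] [DecidableEq ι] [Fintype Ω] (f : ι → Ω → ℝ) :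
    𝔼 σ : ι → Ω, ∏ i, f i (σ i) = ∏ i, 𝔼 ω, f i ω := by
  simp only [Fintype.expect_eq_sum_div_card, Finset.prod_div_distrib, Finset.prod_univ_sum,
    Fintype.piFinset_univ, Finset.prod_const, Finset.card_univ, Fintype.card_fun, Nat.cast_pow]

lemma card_filter_mul_le_card_mul_expect {Ω : Type*} [Fintype Ω] (f : Ω → ℝ) (hf : ∀ ω, 0 ≤ f ω)
    (c : ℝ) : ((Finset.univ.filter fun ω => c ≤ f ω).card : ℝ) * c ≤
      Fintype.card Ω * 𝔼 ω, f ω := by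
  rw [Fintype.card_mul_expect, ← nsmul_eq_mul]
  exact (Finset.card_nsmul_le_sum _ _ _ fun ω hω => (Finset.mem_filter.1 hω).2).trans
    (Finset.sum_le_sum_of_subset_of_nonneg (Finset.subset_univ _) fun ω _ _ => hf ω)

/-- The Chernoff bound for `q` independent copies of a random variable. -/
lemma card_filter_mul_le_sum_le {Ω : Type*} [Fintype Ω] (f : Ω → ℝ) {a b : ℝ}
    (h : 𝔼 ω, Real.exp (f ω) ≤ Real.exp b) (q : ℕ) :
    ((Finset.univ.filter fun Q : Fin q → Ω => a * q ≤ ∑ i, f (Q i)).card : ℝ) ≤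
      Real.exp (-(a - b) * q) * Fintype.card (Fin q → Ω) := by
  classical
  have hmarkov := card_filter_mul_le_card_mul_expect
    (fun Q : Fin q → Ω => Real.exp (∑ i, f (Q i))) (fun _ => (Real.exp_pos _).le)
    (Real.exp (a * q))
  simp only [Real.exp_le_exp] at hmarkov
  simp only [Real.exp_sum] at hmarkov
  rw [expect_prod_apply fun (_ : Fin q) ω => Real.exp (f ω), Finset.prod_const, Finset.card_univ,
    Fintype.card_fin, ← le_div_iff₀ (Real.exp_pos _)] at hmarkov
  calc _ ≤ Fintype.card (Fin q → Ω) * (𝔼 ω, Real.exp (f ω)) ^ q / Real.exp (a * q) := hmarkov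
    _ ≤ Fintype.card (Fin q → Ω) * Real.exp b ^ q / Real.exp (a * q) := by
        gcongr
    _ = _ := by
        rw [← Real.exp_nat_mul, mul_div_assoc, ← Real.exp_sub, mul_comm, neg_sub, sub_mul,
          mul_comm b]

lemma sgn_mul_self (b : Bool) : sgn b * sgn b = 1 := by cases b <;> simp [sgn]

lemma sgn_not (b : Bool) : sgn (!b) = -sgn b := by cases b <;> simp [sgn]

variable {ι : Type*} [Fintype ι]

/-- The sum of the entries of `y` with the signs `σ`. -/
def signedSum (y : ι → ℝ) (σ : ι → Bool) : ℝ := ∑ e, sgn (σ e) * y e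

lemma signedSum_smul (c : ℝ) (y : ι → ℝ) (σ : ι → Bool) :
    signedSum (c • y) σ = c * signedSum y σ := by
  simp only [signedSum, Pi.smul_apply, smul_eq_mul, mul_left_comm, Finset.mul_sum]

section Moments

variable [DecidableEq ι]

lemma expect_exp_mul_signedSum_le (y : ι → ℝ) (t : ℝ) :
    𝔼 σ, Real.exp (t * signedSum y σ) ≤ Real.exp (t ^ 2 * (∑ e, y e ^ 2) / 2) :=
  calc 𝔼 σ, Real.exp (t * signedSum y σ)
      = 𝔼 σ : ι → Bool, ∏ e, Real.exp (t * (sgn (σ e) * y e)) := by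
        simp only [signedSum, Finset.mul_sum, Real.exp_sum]
    _ = ∏ e, Real.cosh (t * y e) := by
        rw [expect_prod_apply fun e b => Real.exp (t * (sgn b * y e))]
        refine Finset.prod_congr rfl fun e _ => ?_
        rw [Fintype.expect_eq_sum_div_card, Fintype.sum_bool, Fintype.card_bool, Real.cosh_eq]
        simp [sgn]
    _ ≤ ∏ e, Real.exp ((t * y e) ^ 2 / 2) :=
        Finset.prod_le_prod (fun e _ => (Real.cosh_pos _).le) fun e _ => Real.cosh_le_exp_half_sq _
    _ = _ := by
        rw [← Real.exp_sum, ← Finset.sum_div, Finset.mul_sum]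
        simp only [mul_pow]

lemma expect_sgn_mul_sgn (e f : ι) :
    𝔼 σ : ι → Bool, sgn (σ e) * sgn (σ f) = if e = f then 1 else 0 := by
  split_ifs with hef
  · simp only [hef, sgn_mul_self, Fintype.expect_const]
  · let flip (σ : ι → Bool) : ι → Bool := Function.update σ e (!σ e)
    have hflip : Function.Involutive flip := fun σ => by simp [flip]
    have hneg : 𝔼 σ : ι → Bool, sgn (σ e) * sgn (σ f) =
        𝔼 σ : ι → Bool, -(sgn (σ e) * sgn (σ f)) :=
      Fintype.expect_equiv hflip.toPerm _ _ fun σ => by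
        simp [flip, Function.update_of_ne (Ne.symm hef), sgn_not]
    rw [Finset.expect_neg_distrib] at hneg
    linarith

lemma expect_signedSum_sq (y : ι → ℝ) : 𝔼 σ, signedSum y σ ^ 2 = ∑ e, y e ^ 2 := by
  have hexpand (σ : ι → Bool) : signedSum y σ ^ 2 =
      ∑ e, ∑ f, y e * y f * (sgn (σ e) * sgn (σ f)) := by
    simp only [sq, signedSum, Finset.sum_mul_sum, mul_mul_mul_comm, mul_comm]
  simp only [hexpand, Finset.expect_sum_comm, ← Finset.mul_expect, expect_sgn_mul_sgn, mul_ite,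
    mul_one, mul_zero, Finset.sum_ite_eq, Finset.mem_univ, if_true, sq]

lemma integral_exp_mul_sq_gaussianReal {t : ℝ} (ht : t < 1 / 2) :
    ∫ g, Real.exp (t * g ^ 2) ∂gaussianReal 0 1 = (√(1 - 2 * t))⁻¹ := by
  have hpdf (g : ℝ) : gaussianPDFReal 0 1 g • Real.exp (t * g ^ 2) =
      (√(2 * Real.pi))⁻¹ * Real.exp (-(1 / 2 - t) * g ^ 2) := by
    rw [gaussianPDFReal, smul_eq_mul, mul_assoc, ← Real.exp_add, NNReal.coe_one, mul_one]
    congr 2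
    ring
  have hscale : Real.pi / (1 / 2 - t) = 2 * Real.pi * (1 - 2 * t)⁻¹ := by
    have : 1 - 2 * t ≠ 0 := by linarith
    have : 1 / 2 - t ≠ 0 := by linarith
    field_simp
  rw [integral_gaussianReal_eq_integral_smul one_ne_zero]
  simp only [hpdf]
  rw [integral_const_mul, integral_gaussian, hscale,
    Real.sqrt_mul (x := 2 * Real.pi) (by positivity), Real.sqrt_inv,
    inv_mul_cancel_left₀ (by positivity)]

/-- Write `exp (t * z ^ 2)` as the average of `exp (√(2 * t) * z * g)` over a Gaussian `g`. -/
lemma expect_exp_mul_signedSum_sq_le {y : ι → ℝ} (hy : ∑ e, y e ^ 2 = 1) {t : ℝ} (ht₀ : 0 ≤ t)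
    (ht : t < 1 / 2) : 𝔼 σ, Real.exp (t * signedSum y σ ^ 2) ≤ (√(1 - 2 * t))⁻¹ := by
  have hsq : √(2 * t) ^ 2 = 2 * t := Real.sq_sqrt (by linarith)
  have hint (c : ℝ) : Integrable (fun g => Real.exp (c * g)) (gaussianReal 0 1) :=
    integrable_exp_mul_gaussianReal c
  have hmgf (c : ℝ) : Real.exp (c ^ 2 / 2) = ∫ g, Real.exp (c * g) ∂gaussianReal 0 1 := by
    simpa [mgf] using (congrFun (mgf_fun_id_gaussianReal (μ := 0) (v := 1)) c).symm
  have hgauss : 0 < (√(1 - 2 * t))⁻¹ := inv_pos.2 (Real.sqrt_pos.2 (by linarith))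
  calc 𝔼 σ, Real.exp (t * signedSum y σ ^ 2)
      = 𝔼 σ, ∫ g, Real.exp (√(2 * t) * signedSum y σ * g) ∂gaussianReal 0 1 := by
        refine Finset.expect_congr rfl fun σ _ => ?_
        rw [← hmgf, mul_pow, hsq]
        ring_nf
    _ = ∫ g, 𝔼 σ, Real.exp (√(2 * t) * signedSum y σ * g) ∂gaussianReal 0 1 := by
        simp only [Fintype.expect_eq_sum_div_card]
        rw [integral_div, integral_finsetSum _ fun σ _ => hint _]
    _ ≤ ∫ g, Real.exp (t * g ^ 2) ∂gaussianReal 0 1 := by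
        refine integral_mono ?_ ?_ fun g => ?_
        · simp only [Fintype.expect_eq_sum_div_card]
          exact (integrable_finsetSum _ fun σ _ => hint _).div_const _
        · refine Integrable.of_integral_ne_zero ?_
          rw [integral_exp_mul_sq_gaussianReal ht]
          exact hgauss.ne'
        · have h := expect_exp_mul_signedSum_le y (√(2 * t) * g)
          rw [hy, mul_one, mul_pow, hsq, mul_assoc 2, mul_div_cancel_left₀ _ two_ne_zero] at h
          simpa only [mul_right_comm] using h
    _ = _ := integral_exp_mul_sq_gaussianReal ht

lemma expect_exp_neg_mul_signedSum_sq_le {y : ι → ℝ} (hy : ∑ e, y e ^ 2 = 1) {t : ℝ}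
    (ht₀ : 0 ≤ t) (ht : t < 1 / 2) :
    𝔼 σ, Real.exp (-t * signedSum y σ ^ 2) ≤ (√(1 - 2 * t))⁻¹ - 2 * t := by
  have hsinh (z : ℝ) (hz : 0 ≤ z) : Real.exp (-z) ≤ Real.exp z - 2 * z := by
    linarith [Real.self_le_sinh_iff.2 hz, Real.sinh_eq z]
  calc 𝔼 σ, Real.exp (-t * signedSum y σ ^ 2)
      ≤ 𝔼 σ, (Real.exp (t * signedSum y σ ^ 2) - 2 * t * signedSum y σ ^ 2) := by
        refine Finset.expect_le_expect fun σ _ => ?_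
        rw [neg_mul, mul_assoc 2]
        exact hsinh _ (by positivity)
    _ = 𝔼 σ, Real.exp (t * signedSum y σ ^ 2) - 2 * t := by
        rw [Finset.expect_sub_distrib, ← Finset.mul_expect, expect_signedSum_sq, hy, mul_one]
    _ ≤ _ := sub_le_sub_right (expect_exp_mul_signedSum_sq_le hy ht₀ ht) _

lemma inv_sqrt_nine_tenths_le : (√(1 - 2 * (1 / 20) : ℝ))⁻¹ ≤ 1 + 11 / 200 := by
  norm_num only []
  rw [inv_le_comm₀ (by positivity) (by norm_num)]
  exact Real.le_sqrt_of_sq_le (by norm_num)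

end Moments

/-- The sign matrix `Q` preserves the squared norm of `y` up to a factor `1 ± 1 / 5`, once it is
scaled by the number of rows. -/
def PreservesNorm {q : ℕ} (Q : Fin q → ι → Bool) (y : ι → ℝ) : Prop :=
  4 / 5 * (q * ∑ e, y e ^ 2) ≤ ∑ i, signedSum y (Q i) ^ 2 ∧
    ∑ i, signedSum y (Q i) ^ 2 ≤ 6 / 5 * (q * ∑ e, y e ^ 2)

lemma preservesNorm_smul_iff {q : ℕ} {Q : Fin q → ι → Bool} {y : ι → ℝ} {c : ℝ} (hc : c ≠ 0) :
    PreservesNorm Q (c • y) ↔ PreservesNorm Q y := by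
  have hc' : 0 < c ^ 2 := by positivity
  simp only [PreservesNorm, signedSum_smul, Pi.smul_apply, smul_eq_mul, mul_pow, ← Finset.mul_sum,
    mul_left_comm _ (c ^ 2), mul_le_mul_iff_right₀ hc']

lemma preservesNorm_zero {q : ℕ} (Q : Fin q → ι → Bool) : PreservesNorm Q 0 := by
  simp [PreservesNorm, signedSum]

open Classical in
lemma card_filter_not_preservesNorm_le_of_sum_sq_eq_one {y : ι → ℝ} (hy : ∑ e, y e ^ 2 = 1)
    (q : ℕ) : ((Finset.univ.filter fun Q : Fin q → ι → Bool => ¬ PreservesNorm Q y).card : ℝ) ≤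
      2 * Real.exp (-q / 1000) * Fintype.card (Fin q → ι → Bool) := by
  have hupper : 𝔼 σ, Real.exp (1 / 20 * signedSum y σ ^ 2) ≤ Real.exp (3 / 50 - 1 / 1000) := by
    refine (expect_exp_mul_signedSum_sq_le hy (by norm_num) (by norm_num)).trans ?_
    linarith [inv_sqrt_nine_tenths_le, Real.add_one_le_exp (59 / 1000 : ℝ)]
  have hlower : 𝔼 σ, Real.exp (-(1 / 20) * signedSum y σ ^ 2) ≤
      Real.exp (-(1 / 25) - 1 / 1000) := by
    refine (expect_exp_neg_mul_signedSum_sq_le hy (by norm_num) (by norm_num)).trans ?_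
    linarith [inv_sqrt_nine_tenths_le, Real.add_one_le_exp (-41 / 1000 : ℝ)]
  have hsub : (Finset.univ.filter fun Q : Fin q → ι → Bool => ¬ PreservesNorm Q y) ⊆
      (Finset.univ.filter fun Q => (3 / 50 : ℝ) * q ≤ ∑ i, 1 / 20 * signedSum y (Q i) ^ 2) ∪
      Finset.univ.filter fun Q => (-(1 / 25) : ℝ) * q ≤ ∑ i, -(1 / 20) * signedSum y (Q i) ^ 2 := by
    intro Q hQ
    simp only [Finset.mem_filter, Finset.mem_univ, true_and, Finset.mem_union, PreservesNorm, hy,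
      mul_one, ← Finset.mul_sum] at hQ ⊢
    grind
  refine (Nat.cast_le.2 ((Finset.card_le_card hsub).trans (Finset.card_union_le _ _))).trans ?_
  rw [Nat.cast_add]
  refine (add_le_add (card_filter_mul_le_sum_le _ hupper q)
    (card_filter_mul_le_sum_le _ hlower q)).trans_eq ?_
  ring_nf

open Classical in
/-- The Johnson–Lindenstrauss lemma of Achlioptas, for one vector. -/
lemma card_filter_not_preservesNorm_le (y : ι → ℝ) (q : ℕ) :
    ((Finset.univ.filter fun Q : Fin q → ι → Bool => ¬ PreservesNorm Q y).card : ℝ) ≤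
      2 * Real.exp (-q / 1000) * Fintype.card (Fin q → ι → Bool) := by
  rcases eq_or_ne (∑ e, y e ^ 2) 0 with hzero | hne
  · obtain rfl : y = 0 := funext fun e => by
      simpa using (Finset.sum_eq_zero_iff_of_nonneg fun e _ => sq_nonneg (y e)).1 hzero e
    simp only [preservesNorm_zero, not_true_eq_false, Finset.filter_false, Finset.card_empty,
      Nat.cast_zero]
    positivity
  · have hpos : 0 < ∑ e, y e ^ 2 := (Finset.sum_nonneg fun e _ => sq_nonneg (y e)).lt_of_ne' hne
    have hunit : ∑ e, ((√(∑ e, y e ^ 2))⁻¹ • y) e ^ 2 = 1 := by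
      simp only [Pi.smul_apply, smul_eq_mul, mul_pow, ← Finset.mul_sum, inv_pow,
        Real.sq_sqrt hpos.le, inv_mul_cancel₀ hne]
    simpa only [preservesNorm_smul_iff (inv_ne_zero (Real.sqrt_pos.2 hpos).ne')] using
      card_filter_not_preservesNorm_le_of_sum_sq_eq_one hunit q

open Classical in
lemma ofReal_one_sub_le_uniformOn_univ {Ω : Type*} [Fintype Ω] [Nonempty Ω] [MeasurableSpace Ω]
    [MeasurableSingletonClass Ω] {p : Ω → Prop} {ε : ℝ}
    (h : ((Finset.univ.filter fun ω => ¬ p ω).card : ℝ) ≤ ε * Fintype.card Ω) :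
    ENNReal.ofReal (1 - ε) ≤ uniformOn Set.univ {ω | p ω} := by
  have hcompl := Finset.card_filter_add_card_filter_not (s := Finset.univ) p
  rw [Finset.card_univ, ← @Nat.cast_inj ℝ, Nat.cast_add] at hcompl
  rw [← Finset.coe_filter_univ, uniformOn_univ, Measure.count_apply_finset,
    ENNReal.le_div_iff_mul_le (Or.inl (by simp)) (Or.inl (by simp)),
    ← ENNReal.ofReal_natCast, ← ENNReal.ofReal_natCast, ← ENNReal.ofReal_mul' (by positivity)]
  exact ENNReal.ofReal_le_ofReal (by linarith)

lemma ofReal_one_sub_le_uniformOn_forall_preservesNorm {κ : Type*} [Fintype κ] (y : κ → ι → ℝ)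
    (q : ℕ) : ENNReal.ofReal (1 - 2 * Fintype.card κ * Real.exp (-q / 1000)) ≤
      uniformOn Set.univ {Q : Fin q → ι → Bool | ∀ k, PreservesNorm Q (y k)} := by
  classical
  refine ofReal_one_sub_le_uniformOn_univ ?_
  calc _ ≤ ((Finset.univ.biUnion fun k => Finset.univ.filter fun Q : Fin q → ι → Bool =>
        ¬ PreservesNorm Q (y k)).card : ℝ) := by
        refine Nat.cast_le.2 (Finset.card_le_card fun Q hQ => ?_)
        simpa using hQ
    _ ≤ ∑ k, ((Finset.univ.filter fun Q : Fin q → ι → Bool => ¬ PreservesNorm Q (y k)).card : ℝ) :=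
        mod_cast Finset.card_biUnion_le
    _ ≤ ∑ _k : κ, 2 * Real.exp (-q / 1000) * Fintype.card (Fin q → ι → Bool) :=
        Finset.sum_le_sum fun k _ => card_filter_not_preservesNorm_le (y k) q
    _ = _ := by
        rw [Finset.sum_const, Finset.card_univ, nsmul_eq_mul]
        ring

end Signs

lemma le_numRows (n : ℕ) : 10 ^ 6 * Real.log n ≤ numRows n := Nat.le_ceil _

lemma two_mul_sq_mul_exp_numRows_le {n : ℕ} (hn : 2 ≤ n) :
    2 * (n : ℝ) ^ 2 * Real.exp (-numRows n / 1000) ≤ 1 / (n : ℝ) ^ 10 := by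
  have hn' : (2 : ℝ) ≤ n := mod_cast hn
  have : 0 ≤ Real.log n := Real.log_natCast_nonneg n
  calc 2 * (n : ℝ) ^ 2 * Real.exp (-numRows n / 1000)
      ≤ n * (n : ℝ) ^ 2 * Real.exp (-((13 : ℕ) * Real.log n)) := by
        gcongr
        push_cast
        linarith [le_numRows n]
    _ = 1 / (n : ℝ) ^ 10 := by
        rw [Real.exp_neg, Real.exp_nat_mul, Real.exp_log (by linarith)]
        field_simp

/-! ### Costed computations -/

namespace Costed

variable {α β : Type}

@[simp] lemma pure_val (x : α) : (pure x : Costed α).val = x := rfl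

@[simp] lemma pure_time (x : α) : (pure x : Costed α).time = 0 := rfl

@[simp] lemma pure_space (x : α) : (pure x : Costed α).space = 0 := rfl

@[simp] lemma bind_val (x : Costed α) (f : α → Costed β) : (x >>= f).val = (f x.val).val := rfl

@[simp] lemma bind_time (x : Costed α) (f : α → Costed β) :
    (x >>= f).time = x.time + (f x.val).time := rfl

@[simp] lemma bind_space (x : Costed α) (f : α → Costed β) :
    (x >>= f).space = x.space + (f x.val).space := rfl

section Fold

variable {γ : Type*} {f : β → γ → Costed β}

lemma foldlM_val (f : β → γ → Costed β) (l : List γ) (b : β) :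
    (l.foldlM f b).val = l.foldl (fun b a => (f b a).val) b := by
  induction l generalizing b with
  | nil => rfl
  | cons a l ih => rw [List.foldlM_cons, bind_val, ih, List.foldl_cons]

/-- Amortized analysis of a loop with potential function `Φ`. -/
lemma foldlM_time_add_le {Φ : β → ℕ} {c : ℕ}
    (h : ∀ b a, (f b a).time + Φ b ≤ c + Φ (f b a).val) (l : List γ) (b : β) :
    (l.foldlM f b).time + Φ b ≤ l.length * c + Φ (l.foldlM f b).val := by
  induction l generalizing b with
  | nil => simp
  | cons a l ih =>
    rw [List.foldlM_cons, bind_time, bind_val, List.length_cons, add_mul, one_mul]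
    linarith [h b a, ih (f b a).val]

lemma foldlM_time_le {c : ℕ} (h : ∀ b a, (f b a).time ≤ c) (l : List γ) (b : β) :
    (l.foldlM f b).time ≤ l.length * c :=
  foldlM_time_add_le (Φ := fun _ => 0) h l b

lemma foldlM_time_eq {c : ℕ} (h : ∀ b a, (f b a).time = c) (l : List γ) (b : β) :
    (l.foldlM f b).time = l.length * c := by
  induction l generalizing b with
  | nil => simp
  | cons a l ih =>
    rw [List.foldlM_cons, bind_time, ih, h, List.length_cons]
    ring

lemma foldlM_space_eq_zero (h : ∀ b a, (f b a).space = 0) (l : List γ) (b : β) :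
    (l.foldlM f b).space = 0 := by
  induction l generalizing b with
  | nil => rfl
  | cons a l ih => rw [List.foldlM_cons, bind_space, ih, h]

end Fold

/-- Filling a memory cell takes at least one step, so that no computation built from `tick` and
`alloc` reserves more cells than it takes steps. -/
def SpaceLeTime (x : Costed α) : Prop := x.space ≤ x.time

lemma SpaceLeTime.pure (x : α) : SpaceLeTime (Pure.pure x : Costed α) := le_rfl

lemma SpaceLeTime.bind {x : Costed α} {f : α → Costed β} (hx : x.SpaceLeTime)
    (hf : ∀ a, (f a).SpaceLeTime) : (x >>= f).SpaceLeTime :=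
  add_le_add hx (hf _)

lemma SpaceLeTime.foldlM {γ : Type*} {f : β → γ → Costed β} (hf : ∀ b a, (f b a).SpaceLeTime)
    (l : List γ) (b : β) : (l.foldlM f b).SpaceLeTime := by
  induction l generalizing b with
  | nil => exact .pure b
  | cons a l ih =>
    rw [List.foldlM_cons]
    exact .bind (hf _ _) ih

end Costed

@[simp] lemma tick_time (t : ℕ) : (tick t).time = t := rfl

@[simp] lemma tick_space (t : ℕ) : (tick t).space = 0 := rfl

@[simp] lemma alloc_time (t : ℕ) : (alloc t).time = t := rfl

section Folds

variable {α β : Type*}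

lemma foldl_add_eq_add_sum {M : Type*} [AddMonoid M] (f : α → M) (l : List α) (b : M) :
    l.foldl (fun b a => b + f a) b = b + (l.map f).sum := by
  induction l generalizing b with
  | nil => simp
  | cons a l ih => rw [List.foldl_cons, ih, List.map_cons, List.sum_cons, add_assoc]

lemma foldl_update_apply [DecidableEq α] (c : α → β) (l : List α) (y : α → β) (x : α) :
    l.foldl (fun y a => Function.update y a (c a)) y x = if x ∈ l then c x else y x := by
  induction l generalizing y with
  | nil => simp
  | cons a l ih =>
    rw [List.foldl_cons, ih]
    grind [Function.update_apply]

lemma foldl_update_cons_apply [DecidableEq β] (label : α → β) (l : List α) (T : β → List α)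
    (x : β) : l.foldl (fun T v => Function.update T (label v) (v :: T (label v))) T x =
      (l.filter fun v => label v = x).reverse ++ T x := by
  induction l generalizing T with
  | nil => simp
  | cons a l ih =>
    rw [List.foldl_cons, ih]
    grind [Function.update_apply]

lemma foldl_max_le_iff [LinearOrder β] (f : α → β) (l : List α) (b t : β) :
    l.foldl (fun b a => max b (f a)) b ≤ t ↔ b ≤ t ∧ ∀ a ∈ l, f a ≤ t := by
  induction l generalizing b with
  | nil => simp
  | cons a l ih => rw [List.foldl_cons, ih, max_le_iff, List.forall_mem_cons, and_assoc]

lemma mem_foldl_ite_insert [DecidableEq α] (p : α → Prop) [DecidablePred p] (l : List α)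
    (P : Finset α) (x : α) :
    x ∈ l.foldl (fun P a => if p a then insert a P else P) P ↔ x ∈ P ∨ x ∈ l ∧ p x := by
  induction l generalizing P with
  | nil => simp
  | cons a l ih =>
    rw [List.foldl_cons, ih]
    grind

end Folds

open Costed

variable {n : ℕ}

lemma incidence_without_apply {G : SimpleGraph (Fin n)} {F : Finset (Pairs n)}
    (hF : ∀ e ∈ F, e.1 ∈ G.edgeSet) (e : Pairs n) (x : Fin n) :
    incidence (without G F) e x = incidence G e x - if e ∈ F then prow e x else 0 := by
  have hmem : e.1 ∈ (without G F).edgeSet ↔ e.1 ∈ G.edgeSet ∧ e ∉ F := by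
    rw [without, SimpleGraph.edgeSet_deleteEdges, Set.mem_sdiff,
      Subtype.val_injective.mem_set_image, Finset.mem_coe]
  by_cases he : e ∈ F
  · simp only [incidence, hmem, he, hF e he, not_true, and_false, if_true, if_false, sub_self]
  · simp only [incidence, if_neg he, sub_zero]
    congr 1
    exact propext (hmem.trans (and_iff_left he))

lemma removeEdges_val {s : ℕ} (S : Matrix (Fin s) (Pairs n) ℝ) {G : SimpleGraph (Fin n)}
    {F : Finset (Pairs n)} (hF : ∀ e ∈ F, e.1 ∈ G.edgeSet) :
    (removeEdges S (S * incidence G) F).val = S * incidence (without G F) := by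
  have hfold : (removeEdges S (S * incidence G) F).val =
      S * incidence G + ∑ e ∈ F, Matrix.of fun i x => -(S i e * prow e x) := by
    rw [removeEdges, foldlM_val, ← Finset.sum_map_toList, ← foldl_add_eq_add_sum]
    rfl
  ext i x
  rw [hfold]
  simp only [Matrix.add_apply, Matrix.sum_apply, Matrix.of_apply, Matrix.mul_apply,
    incidence_without_apply hF, mul_sub, mul_ite, mul_zero, Finset.sum_sub_distrib,
    Finset.sum_ite_mem, Finset.univ_inter, Finset.sum_neg_distrib]
  exact (sub_eq_add_neg _ _).symm

lemma removeEdges_time {s : ℕ} (S : Matrix (Fin s) (Pairs n) ℝ) (Y : Matrix (Fin s) (Fin n) ℝ)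
    (F : Finset (Pairs n)) : (removeEdges S Y F).time = F.card * (1 + 10 * s) := by
  rw [removeEdges, foldlM_time_eq (c := 1 + 10 * s) (fun _ _ => by simp), Finset.length_toList]

lemma removeEdges_space {s : ℕ} (S : Matrix (Fin s) (Pairs n) ℝ) (Y : Matrix (Fin s) (Fin n) ℝ)
    (F : Finset (Pairs n)) : (removeEdges S Y F).space = 0 :=
  foldlM_space_eq_zero (fun _ _ => by simp) _ _

lemma componentLists_val (label : Fin n → Fin n) (x : Fin n) :
    (componentLists label).val x = ((List.finRange n).filter fun v => label v = x).reverse := by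
  rw [componentLists, bind_val, foldlM_val]
  exact (foldl_update_cons_apply label _ _ x).trans (List.append_nil _)

lemma mem_componentLists (label : Fin n → Fin n) (u v : Fin n) :
    v ∈ (componentLists label).val (label u) ↔ label v = label u := by
  simp [componentLists_val]

lemma nodup_componentLists (label : Fin n → Fin n) (x : Fin n) :
    ((componentLists label).val x).Nodup := by
  rw [componentLists_val, List.nodup_reverse]
  exact (List.nodup_finRange n).filter _

lemma componentLists_time (label : Fin n → Fin n) : (componentLists label).time = n + n * 6 := by
  rw [componentLists, bind_time, foldlM_time_eq (c := 6) (fun _ _ => by simp),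
    List.length_finRange, alloc_time]

lemma combineRows_val (H : WGraph n) (σ : Pairs n ⊕ Fin n → Bool) :
    (combineRows H σ).val = H.inc.transpose.mulVec fun j => sgn (σ j) := by
  have hupdate (y : Fin n → ℝ) (v : Fin n) (c : ℝ) :
      Function.update y v (y v + c) = y + Pi.single v c := by
    ext x
    by_cases hx : x = v <;> simp [hx]
  have hfold : (combineRows H σ).val =
      ∑ e ∈ H.edges, (sgn (σ (Sum.inl e)) * Real.sqrt (H.w e)) • prow e +
        ∑ v, Pi.single v (sgn (σ (Sum.inr v)) * Real.sqrt H.reg) := by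
    simp only [combineRows, bind_val, foldlM_val, pure_val, hupdate, foldl_add_eq_add_sum,
      zero_add, Finset.sum_map_toList, Fin.sum_univ_def]
  have hweight (e : Pairs n) (he : e ∉ H.edges) : H.w e = 0 := by simpa [WGraph.edges] using he
  have hedges : ∑ e ∈ H.edges, (sgn (σ (Sum.inl e)) * Real.sqrt (H.w e)) • prow e =
      ∑ e, (sgn (σ (Sum.inl e)) * Real.sqrt (H.w e)) • prow e :=
    Finset.sum_subset (Finset.subset_univ _) fun e _ he => by simp [hweight e he]
  ext x
  rw [hfold, hedges, Matrix.mulVec, dotProduct, Fintype.sum_sum_type]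
  simp [WGraph.inc, Pi.single_apply, mul_comm, mul_assoc]

lemma combineRows_time (H : WGraph n) (σ : Pairs n ⊕ Fin n → Bool) :
    (combineRows H σ).time = n + (H.edges.card * 14 + n * 7) := by
  rw [combineRows, bind_time, bind_time, foldlM_time_eq (c := 14) (fun _ _ => by simp),
    foldlM_time_eq (c := 7) (fun _ _ => by simp), List.length_finRange, Finset.length_toList,
    alloc_time]

lemma embedding_val (a : ℕ) (H : WGraph n) (Q : Signs n) (i : Fin (numRows n)) :
    (embedding a H Q).val i = (Real.sqrt (numRows n))⁻¹ •
      (pinv H.laplacian).mulVec (H.inc.transpose.mulVec fun j => sgn (Q i j)) := by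
  rw [← combineRows_val, embedding, bind_val, foldlM_val]
  exact (foldl_update_apply (fun i => (Real.sqrt (numRows n))⁻¹ •
    (pinv H.laplacian).mulVec (combineRows H (Q i)).val) _ _ i).trans
    (if_pos (List.mem_finRange i))

lemma embedding_time (a : ℕ) (H : WGraph n) (Q : Signs n) :
    (embedding a H Q).time = numRows n * n + numRows n *
      (n + (H.edges.card * 14 + n * 7) + (nearlyLinear a n (H.edges.card + n) + (3 + 4 * n))) := by
  rw [embedding, bind_time, foldlM_time_eq
    (c := n + (H.edges.card * 14 + n * 7) + (nearlyLinear a n (H.edges.card + n) + (3 + 4 * n)))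
    (fun _ _ => by simp [combineRows_time, laplacianSolve]), List.length_finRange, alloc_time]

section Distances

variable {q : ℕ} (M : Matrix (Fin q) (Fin n) ℝ) (u v : Fin n)

lemma resM_val : (resM M u v).val = 5 / 4 * ∑ i, (M i u - M i v) ^ 2 := by
  rw [resM, bind_val, bind_val, pure_val, sqDist, foldlM_val, Fin.sum_univ_def]
  exact congrArg _ ((foldl_add_eq_add_sum _ _ _).trans (zero_add _))

lemma resM_time : (resM M u v).time = q * 6 + 1 := by
  rw [resM, bind_time, sqDist, foldlM_time_eq (c := 6) (fun _ _ => by simp),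
    List.length_finRange]
  rfl

lemma resM_comm : (resM M u v).val = (resM M v u).val := by
  simp only [resM_val, sub_sq_comm (M _ u)]

lemma resM_self : (resM M u u).val = 0 := by
  simp [resM_val]

lemma maxResM_le_iff (C : List (Fin n)) {t : ℝ} (ht : 0 ≤ t) :
    (maxResM M u C).val ≤ t ↔ ∀ v ∈ C, (resM M u v).val ≤ t := by
  rw [maxResM, foldlM_val]
  exact (foldl_max_le_iff _ C 0 t).trans (and_iff_right ht)

lemma maxResM_time (C : List (Fin n)) : (maxResM M u C).time = C.length * (q * 6 + 5) := by
  rw [maxResM, foldlM_time_eq (c := q * 6 + 5) (fun _ _ => by simp [resM_time])]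

lemma carve_val {r : ℝ} (hr : 0 ≤ r) {A : Finset (Fin n)} (hu : u ∈ A) :
    (carve M r A u).val = A.filter fun v => (resM M u v).val ≤ r := by
  have hfold : (carve M r A u).val = (List.finRange n).foldl (fun P v =>
      if v ∈ A \ {u} ∧ (resM M u v).val ≤ r then insert v P else P) {u} := by
    rw [carve, bind_val, foldlM_val]
    congr 1
    ext P v : 2
    rw [bind_val, ite_and]
    split_ifs <;> simp [*]
  ext v
  rw [hfold, mem_foldl_ite_insert, Finset.mem_filter]
  simp only [Finset.mem_singleton, List.mem_finRange, Finset.mem_sdiff, true_and]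
  grind [resM_self]

lemma carve_time_le (r : ℝ) (A : Finset (Fin n)) :
    (carve M r A u).time ≤ 2 + n * (q * 6 + 8) := by
  rw [carve, bind_time, alloc_time]
  refine Nat.add_le_add_left ((foldlM_time_le (c := q * 6 + 8) (fun P v => ?_) _ _).trans_eq
    (by rw [List.length_finRange])) _
  split_ifs
  · simp only [bind_time, tick_time, resM_time]
    split_ifs <;> simp <;> omega
  · simp

end Distances

/-! ### The main loop -/

/-- The invariant of the main loop, for the distances `R` and the partition of the vertices into
the fibres of `label`; `U` is the set of the centres of the sets output so far. -/
structure LoopInv (R : Fin n → Fin n → ℝ) (r : ℝ) (label : Fin n → Fin n) (X : LoopState n)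
    (U : Finset (Fin n)) : Prop where
  active_subset : X.active ⊆ X.rest
  pairwise_disjoint : X.out.Pairwise Disjoint
  disjoint_rest : ∀ P ∈ X.out, Disjoint P X.rest
  exists_centre : ∀ P ∈ X.out, ∃ u, ∀ v ∈ P, R u v ≤ r
  card_eq : U.card = X.out.length
  far_rest : ∀ u ∈ U, ∀ v ∈ X.rest, r < R u v
  separated : (U : Set (Fin n)).Pairwise fun u v => r < R u v
  exists_far : ∀ u ∈ U, ∃ v, label v = label u ∧ r / 2 < R u v

namespace LoopInv

variable {R : Fin n → Fin n → ℝ} {r : ℝ} {label : Fin n → Fin n} {X : LoopState n}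
  {U : Finset (Fin n)}

lemma init : LoopInv R r label { active := Finset.univ, rest := Finset.univ, out := [] } ∅ where
  active_subset := le_rfl
  pairwise_disjoint := List.Pairwise.nil
  disjoint_rest := by simp
  exists_centre := by simp
  card_eq := rfl
  far_rest := by simp
  separated := by simp
  exists_far := by simp

lemma settle (h : LoopInv R r label X U) (C : Finset (Fin n)) :
    LoopInv R r label { X with active := X.active \ C } U :=
  { h with active_subset := Finset.sdiff_subset.trans h.active_subset }

lemma carve (h : LoopInv R r label X U) (hcomm : ∀ u v, R u v = R v u) {u : Fin n}
    (hself : R u u ≤ r) (hu : u ∈ X.rest) (hfar : ∃ v, label v = label u ∧ r / 2 < R u v)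
    {P : Finset (Fin n)} (hP : P = X.rest.filter fun v => R u v ≤ r) :
    LoopInv R r label { active := X.active \ P, rest := X.rest \ P, out := X.out ++ [P] }
      (insert u U) where
  active_subset := Finset.sdiff_subset_sdiff h.active_subset le_rfl
  pairwise_disjoint := by
    rw [List.pairwise_append]
    refine ⟨h.pairwise_disjoint, List.pairwise_singleton _ _, fun A hA B hB => ?_⟩
    rw [List.mem_singleton.1 hB, hP]
    exact (h.disjoint_rest A hA).mono_right (Finset.filter_subset _ _)
  disjoint_rest := by
    simp only [List.forall_mem_append, List.forall_mem_singleton]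
    exact ⟨fun A hA => (h.disjoint_rest A hA).mono_right Finset.sdiff_subset,
      Finset.disjoint_sdiff⟩
  exists_centre := by
    simp only [List.forall_mem_append, List.forall_mem_singleton]
    exact ⟨h.exists_centre, u, by simp [hP]⟩
  card_eq := by
    have hnot : u ∉ U := fun hU => (h.far_rest u hU u hu).not_ge hself
    rw [Finset.card_insert_of_notMem hnot, h.card_eq, List.length_append, List.length_singleton]
  far_rest := by
    simp only [hP, Finset.mem_sdiff, Finset.mem_filter, Finset.forall_mem_insert]
    exact ⟨fun v hv => not_le.1 fun hle => hv.2 ⟨hv.1, hle⟩,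
      fun c hc v hv => h.far_rest c hc v hv.1⟩
  separated := by
    have hfar (c) (hc : c ∈ U) : r < R c u := h.far_rest c hc u hu
    rw [Finset.coe_insert, Set.pairwise_insert]
    exact ⟨h.separated, fun c hc _ => ⟨hcomm u c ▸ hfar c hc, hfar c hc⟩⟩
  exists_far := Finset.forall_mem_insert _ _ _ |>.2 ⟨hfar, h.exists_far⟩

end LoopInv

section Visit

variable {q : ℕ} {M : Matrix (Fin q) (Fin n) ℝ} {r : ℝ} {comp : Fin n → List (Fin n)}
  {X : LoopState n} {u : Fin n}

lemma visit_of_notMem (hu : u ∉ X.active) :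
    (visit M r comp X u).val = X ∧ (visit M r comp X u).time = 3 := by
  simp [visit, hu]

lemma visit_of_le (hu : u ∈ X.active) (hR : (maxResM M u (comp u)).val ≤ r / 2) :
    (visit M r comp X u).val = { X with active := X.active \ (comp u).toFinset } ∧
      (visit M r comp X u).time = 7 + (comp u).length * (q * 6 + 8) := by
  refine ⟨by simp [visit, hu, hR], ?_⟩
  simp only [visit, hu, hR, bind_time, tick_time, maxResM_time, pure_time, if_true]
  ring

lemma visit_of_not_le (hu : u ∈ X.active) (hR : ¬ (maxResM M u (comp u)).val ≤ r / 2) :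
    (visit M r comp X u).val =
        { active := X.active \ (carve M r X.rest u).val
          rest := X.rest \ (carve M r X.rest u).val
          out := X.out ++ [(carve M r X.rest u).val] } ∧
      (visit M r comp X u).time = 9 + (comp u).length * (q * 6 + 5) +
        (carve M r X.rest u).time + 6 * (carve M r X.rest u).val.card := by
  refine ⟨by simp [visit, hu, hR], ?_⟩
  simp only [visit, hu, hR, bind_time, tick_time, alloc_time, maxResM_time, pure_time, if_true,
    if_false]
  ring

variable {label : Fin n → Fin n}

lemma LoopInv.visit {U : Finset (Fin n)} (h : LoopInv (fun u v => (resM M u v).val) r label X U)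
    (hr : 0 ≤ r) (hcomp : ∀ u v, v ∈ comp u ↔ label v = label u) (u : Fin n) :
    ∃ U', LoopInv (fun u v => (resM M u v).val) r label (visit M r comp X u).val U' := by
  by_cases hu : u ∈ X.active
  · by_cases hR : (maxResM M u (comp u)).val ≤ r / 2
    · exact ⟨U, (visit_of_le hu hR).1 ▸ h.settle _⟩
    · have hrest := h.active_subset hu
      rw [(visit_of_not_le hu hR).1]
      rw [maxResM_le_iff M u _ (by linarith)] at hR
      push Not at hR
      exact ⟨insert u U, h.carve (resM_comm M) ((resM_self M u).trans_le hr) hrest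
        (by simpa only [hcomp] using hR) (carve_val M u hr hrest)⟩
  · exact ⟨U, (visit_of_notMem hu).1.symm ▸ h⟩

/-- The vertices whose component has no active vertex. -/
def settled (comp : Fin n → List (Fin n)) (X : LoopState n) : Finset (Fin n) :=
  Finset.univ.filter fun v => ∀ w ∈ comp v, w ∉ X.active

lemma settled_mono {X Y : LoopState n} (h : Y.active ⊆ X.active) :
    settled comp X ⊆ settled comp Y :=
  Finset.monotone_filter_right _ fun _ _ hv w hw hY => hv w hw (h hY)

lemma card_settled_add_length_le (hcomp : ∀ u v, v ∈ comp u ↔ label v = label u)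
    (hnodup : (comp u).Nodup) (hu : u ∈ X.active) :
    (settled comp X).card + (comp u).length ≤
      (settled comp { X with active := X.active \ (comp u).toFinset }).card := by
  have hdisj : Disjoint (settled comp X) (comp u).toFinset := by
    rw [Finset.disjoint_right]
    intro v hv hsettled
    rw [List.mem_toFinset, hcomp] at hv
    exact (Finset.mem_filter.1 hsettled).2 u ((hcomp v u).2 hv.symm) hu
  rw [← List.toFinset_card_of_nodup hnodup, ← Finset.card_union_of_disjoint hdisj]
  refine Finset.card_le_card
    (Finset.union_subset (settled_mono Finset.sdiff_subset) fun v hv => ?_)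
  simp only [settled, List.mem_toFinset, hcomp, Finset.mem_filter, Finset.mem_univ,
    Finset.mem_sdiff] at hv ⊢
  exact ⟨trivial, fun w hw hact => hact.2 (hw.trans hv)⟩

/-- A scan of a component is paid for by its vertices if they are settled by it, and by the set
that is output otherwise. -/
lemma visit_time_add_le (hcomp : ∀ u v, v ∈ comp u ↔ label v = label u)
    (hnodup : ∀ u, (comp u).Nodup) (X : LoopState n) (u : Fin n) :
    (visit M r comp X u).time +
        ((q * 6 + 8) * (settled comp X).card + (4 + n * (q * 12 + 19)) * X.out.length) ≤
      7 + ((q * 6 + 8) * (settled comp (visit M r comp X u).val).card +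
        (4 + n * (q * 12 + 19)) * (visit M r comp X u).val.out.length) := by
  by_cases hu : u ∈ X.active
  · by_cases hR : (maxResM M u (comp u)).val ≤ r / 2
    · have hsettled := Nat.mul_le_mul_left (q * 6 + 8)
        (card_settled_add_length_le hcomp (hnodup u) hu)
      rw [(visit_of_le hu hR).1, (visit_of_le hu hR).2]
      linarith
    · have hsettled : (settled comp X).card ≤ (settled comp (visit M r comp X u).val).card := by
        rw [(visit_of_not_le hu hR).1]
        exact Finset.card_le_card (settled_mono Finset.sdiff_subset)
      have hout : (visit M r comp X u).val.out.length = X.out.length + 1 := by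
        rw [(visit_of_not_le hu hR).1, List.length_append, List.length_singleton]
      have hscan : (comp u).length * (q * 6 + 5) ≤ n * (q * 6 + 5) :=
        Nat.mul_le_mul_right _ ((hnodup u).length_le_card.trans_eq (Fintype.card_fin n))
      have hcard := card_finset_fin_le (carve M r X.rest u).val
      rw [hout, (visit_of_not_le hu hR).2]
      linarith [carve_time_le M u r X.rest, Nat.mul_le_mul_left (q * 6 + 8) hsettled]
  · rw [(visit_of_notMem hu).1, (visit_of_notMem hu).2]
    omega

lemma exists_loopInv_foldlM_visit (hr : 0 ≤ r) (hcomp : ∀ u v, v ∈ comp u ↔ label v = label u)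
    (l : List (Fin n)) :
    ∃ U, LoopInv (fun u v => (resM M u v).val) r label (l.foldlM (visit M r comp)
      { active := Finset.univ, rest := Finset.univ, out := [] }).val U := by
  rw [foldlM_val]
  exact List.foldlRecOn (motive := fun X => ∃ U, LoopInv _ r label X U) l _ ⟨∅, LoopInv.init⟩
    fun _ ⟨_, h⟩ u _ => h.visit hr hcomp u

lemma foldlM_visit_time_le (hcomp : ∀ u v, v ∈ comp u ↔ label v = label u)
    (hnodup : ∀ u, (comp u).Nodup) (l : List (Fin n)) :
    let X := l.foldlM (visit M r comp)
      { active := Finset.univ, rest := Finset.univ, out := [] }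
    X.time ≤ l.length * 7 + n * (q * 6 + 8) + (4 + n * (q * 12 + 19)) * X.val.out.length := by
  intro X
  have hpotential := foldlM_time_add_le (visit_time_add_le (M := M) (r := r) hcomp hnodup) l
    { active := Finset.univ, rest := Finset.univ, out := [] }
  have hsettled := Nat.mul_le_mul_left (q * 6 + 8) (card_finset_fin_le (settled comp X.val))
  rw [List.length_nil, mul_zero, add_zero] at hpotential
  linarith [(Nat.le_add_right _ _).trans hpotential]

end Visit

/-! ### Space -/

section Space

variable {q : ℕ}

lemma spaceLeTime_tick (t : ℕ) : (tick t).SpaceLeTime := Nat.zero_le t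

lemma spaceLeTime_alloc (t : ℕ) : (alloc t).SpaceLeTime := le_rfl

lemma spaceLeTime_resM (M : Matrix (Fin q) (Fin n) ℝ) (u v : Fin n) : (resM M u v).SpaceLeTime :=
  .bind (.foldlM (fun _ _ => .bind (spaceLeTime_tick _) fun _ => .pure _) _ _) fun _ =>
    .bind (spaceLeTime_tick _) fun _ => .pure _

lemma spaceLeTime_maxResM (M : Matrix (Fin q) (Fin n) ℝ) (u : Fin n) (C : List (Fin n)) :
    (maxResM M u C).SpaceLeTime :=
  .foldlM (fun _ _ => .bind (spaceLeTime_resM ..) fun _ =>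
    .bind (spaceLeTime_tick _) fun _ => .pure _) _ _

lemma spaceLeTime_carve (M : Matrix (Fin q) (Fin n) ℝ) (r : ℝ) (A : Finset (Fin n)) (u : Fin n) :
    (carve M r A u).SpaceLeTime := by
  refine .bind (spaceLeTime_alloc _) fun _ => .foldlM (fun P v =>
    .bind (spaceLeTime_tick _) fun _ => ?_) _ _
  split_ifs
  · refine .bind (spaceLeTime_resM ..) fun s => .bind (spaceLeTime_tick _) fun _ => ?_
    split_ifs
    · exact .bind (spaceLeTime_alloc _) fun _ => .pure _
    · exact .pure _
  · exact .pure _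

lemma spaceLeTime_visit (M : Matrix (Fin q) (Fin n) ℝ) (r : ℝ) (comp : Fin n → List (Fin n))
    (X : LoopState n) (u : Fin n) : (visit M r comp X u).SpaceLeTime := by
  refine .bind (spaceLeTime_tick _) fun _ => ?_
  split_ifs
  · refine .bind (spaceLeTime_maxResM ..) fun R => .bind (spaceLeTime_tick _) fun _ => ?_
    split_ifs
    · exact .bind (spaceLeTime_tick _) fun _ => .pure _
    · exact .bind (spaceLeTime_carve ..) fun _ => .bind (spaceLeTime_tick _) fun _ =>
        .bind (spaceLeTime_alloc _) fun _ => .pure _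
  · exact .pure _

lemma spaceLeTime_componentLists (label : Fin n → Fin n) : (componentLists label).SpaceLeTime :=
  .bind (spaceLeTime_alloc _) fun _ => .foldlM (fun _ _ => .bind (spaceLeTime_tick _) fun _ =>
    .bind (spaceLeTime_alloc _) fun _ => .pure _) _ _

lemma spaceLeTime_combineRows (H : WGraph n) (σ : Pairs n ⊕ Fin n → Bool) :
    (combineRows H σ).SpaceLeTime :=
  .bind (spaceLeTime_alloc _) fun _ => .bind
    (.foldlM (fun _ _ => .bind (spaceLeTime_tick _) fun _ => .pure _) _ _) fun _ =>
      .foldlM (fun _ _ => .bind (spaceLeTime_tick _) fun _ => .pure _) _ _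

lemma spaceLeTime_embedding (a : ℕ) (H : WGraph n) (Q : Signs n) : (embedding a H Q).SpaceLeTime :=
  .bind (spaceLeTime_alloc _) fun _ => .foldlM (fun _ _ => .bind (spaceLeTime_combineRows ..)
    fun _ => .bind (.bind (spaceLeTime_alloc _) fun _ => .pure _) fun _ =>
      .bind (spaceLeTime_tick _) fun _ => .pure _) _ _

lemma spaceLeTime_carveFromSketch (a : ℕ) {s : ℕ}
    (decode : Matrix (Fin s) (Fin n) ℝ → Fin n → Fin n) (Y : Matrix (Fin s) (Fin n) ℝ) (r : ℝ)
    (H : WGraph n) (π : Equiv.Perm (Fin n)) (Q : Signs n) :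
    (carveFromSketch a decode Y r H π Q).SpaceLeTime :=
  .bind (spaceLeTime_alloc _) fun _ => .bind (.bind (spaceLeTime_alloc _) fun _ => .pure _)
    fun _ => .bind (spaceLeTime_componentLists _) fun _ => .bind (spaceLeTime_embedding ..)
      fun _ => .bind (spaceLeTime_alloc _) fun _ => .bind
        (.foldlM (fun _ _ => spaceLeTime_visit ..) _ _) fun _ => .pure _

end Space

/-! ### The embedding -/

/-- The flow `B̃ L̃⁺ b_{uv}` that the unit current from `u` to `v` sends through the rows of `B̃`,
scaled by the square roots of their resistances; its squared norm is the effective resistance. -/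
def currents (H : WGraph n) (u v : Fin n) : Pairs n ⊕ Fin n → ℝ :=
  H.inc *ᵥ (pinv H.laplacian *ᵥ bvec u v)

lemma sum_currents_sq {H : WGraph n} {u v : Fin n} (huv : CarriesCurrent H.laplacian u v) :
    ∑ e, currents H u v e ^ 2 = reff H.laplacian u v := by
  calc ∑ e, currents H u v e ^ 2 = currents H u v ⬝ᵥ currents H u v := by
        simp only [dotProduct, sq]
    _ = (pinv H.laplacian *ᵥ bvec u v) ⬝ᵥ
          (H.laplacian *ᵥ (pinv H.laplacian *ᵥ bvec u v)) :=
        (H.dotProduct_laplacian_mulVec _ _).symm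
    _ = reff H.laplacian u v := by
        rw [mulVec_pinv_mulVec H.isNetworkLaplacian_laplacian.isHermitian huv, dotProduct_comm,
          reff]

lemma embedding_sub (a : ℕ) (H : WGraph n) (Q : Signs n) (i : Fin (numRows n)) (u v : Fin n) :
    (embedding a H Q).val i u - (embedding a H Q).val i v =
      (√(numRows n))⁻¹ * signedSum (currents H u v) (Q i) := by
  rw [← bvec_dotProduct, embedding_val, dotProduct_smul, smul_eq_mul,
    dotProduct_mulVec_comm (pinv_isHermitian H.isNetworkLaplacian_laplacian.isHermitian),
    dotProduct_comm, Matrix.dotProduct_mulVec, Matrix.vecMul_transpose, dotProduct_comm]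
  rfl

lemma resM_embedding (a : ℕ) (H : WGraph n) (Q : Signs n) (u v : Fin n) :
    (resM (embedding a H Q).val u v).val =
      5 / 4 * ((∑ i, signedSum (currents H u v) (Q i) ^ 2) / numRows n) := by
  simp only [resM_val, embedding_sub, mul_pow, inv_pow, Real.sq_sqrt (Nat.cast_nonneg _),
    ← Finset.mul_sum, div_eq_inv_mul]

lemma resM_embedding_mem_Icc (a : ℕ) {H : WGraph n} {Q : Signs n} (hq : 0 < numRows n)
    {u v : Fin n} (huv : CarriesCurrent H.laplacian u v)
    (hQ : PreservesNorm Q (currents H u v)) :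
    (resM (embedding a H Q).val u v).val ∈
      Set.Icc (reff H.laplacian u v) (3 / 2 * reff H.laplacian u v) := by
  have hq' : (0 : ℝ) < numRows n := Nat.cast_pos.2 hq
  obtain ⟨hlow, hup⟩ := hQ
  rw [sum_currents_sq huv, mul_left_comm, ← le_div_iff₀' hq'] at hlow
  rw [sum_currents_sq huv, mul_left_comm, ← div_le_iff₀' hq'] at hup
  rw [resM_embedding]
  constructor <;> linarith

/-! ### The procedure after the update of the sketch -/

open Classical in
/-- A minimum cut between `u` and `v` is crossed by an edge that was not removed. -/
lemma lt_edgeConn_of_reachable_without {G : SimpleGraph (Fin n)} {F : Finset (Pairs n)} {d : ℝ}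
    (hF : ∀ e : Pairs n, ∀ u v, e.1 = s(u, v) → G.Adj u v → (edgeConn G u v : ℝ) ≤ d → e ∈ F)
    {u v : Fin n} (hne : u ≠ v) (huv : (without G F).Reachable u v) : d < edgeConn G u v := by
  obtain ⟨p⟩ := huv
  obtain ⟨S, hu, hv, hS⟩ := Nat.sInf_mem
    (s := {m | ∃ S : Finset (Fin n), u ∈ S ∧ v ∉ S ∧ (G.interedges S Sᶜ).card = m})
    ⟨_, {u}, Finset.mem_singleton_self u, by simpa using hne.symm, rfl⟩
  obtain ⟨e, -, hfst, hsnd⟩ := p.exists_boundary_dart S hu hv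
  obtain ⟨hadj, hkept⟩ :=
    (SimpleGraph.deleteEdges_adj (s := Subtype.val '' (F : Set (Pairs n)))).1 e.adj
  have hdiag : ¬ s(e.fst, e.snd).IsDiag := Sym2.mk_isDiag_iff.not.2 hadj.ne
  have hlt : d < edgeConn G e.fst e.snd := lt_of_not_ge fun hle =>
    hkept ⟨⟨s(e.fst, e.snd), hdiag⟩, hF _ _ _ rfl hadj hle, rfl⟩
  refine hlt.trans_le (Nat.cast_le.2 ?_)
  calc edgeConn G e.fst e.snd ≤ (G.interedges S Sᶜ).card := by
        convert edgeConn_le_card_interedges G hfst hsnd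
    _ = edgeConn G u v := hS

lemma log_le_natLog_add_one (n : ℕ) : Real.log n ≤ Nat.log 2 n + 1 := by
  rcases n.eq_zero_or_pos with rfl | hn
  · simp
  have hlt : (n : ℝ) ≤ 2 ^ (Nat.log 2 n + 1) :=
    mod_cast (Nat.lt_pow_succ_log_self one_lt_two n).le
  calc Real.log n ≤ Real.log (2 ^ (Nat.log 2 n + 1)) := Real.log_le_log (mod_cast hn) hlt
    _ = (Nat.log 2 n + 1) * Real.log 2 := by rw [Real.log_pow, Nat.cast_succ]
    _ ≤ (Nat.log 2 n + 1) * 1 := by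
        gcongr
        linarith [Real.log_two_lt_d9]
    _ = _ := mul_one _

lemma natLog_add_one_le_three_mul_log (hn : 2 ≤ n) : (Nat.log 2 n + 1 : ℝ) ≤ 3 * Real.log n := by
  have hlog_two : (0.6931471803 : ℝ) < Real.log 2 := Real.log_two_gt_d9
  have hmono : Real.log 2 ≤ Real.log n := Real.log_le_log two_pos (mod_cast hn)
  have hfloor : Nat.log 2 n * Real.log 2 ≤ Real.log n :=
    (le_div_iff₀ (by linarith)).1 (mod_cast Real.natLog_le_logb n 2)
  nlinarith [Nat.cast_nonneg (α := ℝ) (Nat.log 2 n)]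

lemma numRows_pos (hn : 2 ≤ n) : 0 < numRows n :=
  Nat.ceil_pos.2 (mul_pos (by norm_num) (Real.log_pos (mod_cast hn)))

lemma numRows_le (n : ℕ) : (numRows n : ℝ) ≤ 2 * 10 ^ 6 * (Nat.log 2 n + 1) := by
  have hceil : (numRows n : ℝ) < 10 ^ 6 * Real.log n + 1 :=
    Nat.ceil_lt_add_one (mul_nonneg (by norm_num) (Real.log_natCast_nonneg n))
  linarith [log_le_natLog_add_one n, Nat.cast_nonneg (α := ℝ) (Nat.log 2 n)]

lemma carveFromSketch_cost_le {n s m A q t : ℕ} (hn : 0 < n) (hq : 0 < q) (hA : 0 < A)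
    (hs : s ≤ A) :
    s * n + 3 * m + 2 + n * A + 9 * n +
        (q * n + q * (n + (m * 14 + n * 7) + ((m + n) * A + (3 + 4 * n)))) +
        n * (q * 6 + 15) + (4 + n * (q * 12 + 19)) * t ≤
      q * A * (60 * n + 18 * m) + 35 * (q * n * t) := by
  have hsn : s * n ≤ A * n := Nat.mul_le_mul_right n hs
  have hAn : A * n ≤ q * (A * n) := Nat.le_mul_of_pos_left _ hq
  have hqn : q * n ≤ A * (q * n) := Nat.le_mul_of_pos_left _ hA
  have hqm : q * m ≤ A * (q * m) := Nat.le_mul_of_pos_left _ hA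
  have hn' : n ≤ q * n := Nat.le_mul_of_pos_left _ hq
  have hm' : m ≤ q * m := Nat.le_mul_of_pos_left _ hq
  have hq' : q ≤ q * n := Nat.le_mul_of_pos_right _ hn
  have ht : t ≤ n * t := Nat.le_mul_of_pos_left _ hn
  have hnt : n * t ≤ q * (n * t) := Nat.le_mul_of_pos_left _ hq
  linarith

lemma exists_loopInv_carveFromSketch {a s : ℕ} (hn : 2 ≤ n) (hs : s ≤ (Nat.log 2 n + 1) ^ a)
    (decode : Matrix (Fin s) (Fin n) ℝ → Fin n → Fin n) (Y : Matrix (Fin s) (Fin n) ℝ) {r : ℝ}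
    (hr : 0 ≤ r) (H : WGraph n) (π : Equiv.Perm (Fin n)) (Q : Signs n) :
    ∃ X U, (carveFromSketch a decode Y r H π Q).val = X.out ∧
      LoopInv (fun u v => (resM (embedding a H Q).val u v).val) r (decode Y) X U ∧
      (carveFromSketch a decode Y r H π Q).time ≤
        numRows n * (Nat.log 2 n + 1) ^ a * (60 * n + 18 * H.edges.card) +
          35 * (numRows n * n * U.card) := by
  let comp (u : Fin n) : List (Fin n) := (componentLists (decode Y)).val (decode Y u)
  have hcomp (u v : Fin n) : v ∈ comp u ↔ decode Y v = decode Y u :=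
    mem_componentLists (decode Y) u v
  let loop := ((List.finRange n).map π).foldlM (visit (embedding a H Q).val r comp)
    { active := Finset.univ, rest := Finset.univ, out := [] }
  obtain ⟨U, hU⟩ := exists_loopInv_foldlM_visit (M := (embedding a H Q).val) hr hcomp
    ((List.finRange n).map π)
  refine ⟨loop.val, U, rfl, hU, ?_⟩
  have hloop : loop.time ≤
      ((List.finRange n).map π).length * 7 + n * (numRows n * 6 + 8) +
        (4 + n * (numRows n * 12 + 19)) * loop.val.out.length :=
    foldlM_visit_time_le hcomp (fun u => nodup_componentLists _ _) _
  have htime : (carveFromSketch a decode Y r H π Q).time =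
      (s * n + 3 * H.edges.card + 2) + (nearlyLinear a n n + ((n + n * 6) +
        ((embedding a H Q).time + (2 * n + loop.time)))) := by
    rw [← componentLists_time (decode Y)]
    rfl
  rw [List.length_map, List.length_finRange, ← hU.card_eq] at hloop
  rw [embedding_time, nearlyLinear, nearlyLinear] at htime
  refine le_trans ?_ (carveFromSketch_cost_le (by lia) (numRows_pos hn) (by positivity) hs)
  linarith

/-! ### The number of sets and the running time -/

lemma card_mul_le_sqrt_of_lt {k Δ r Γ : ℝ} (hk : 0 < k) (hr : 0 < r) (hΓ : 0 < Γ)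
    (hΔ : Δ < r / Γ / (800 * √k)) : k * (Δ * Γ / r) ≤ √k / 800 := by
  have : 0 < √k := Real.sqrt_pos.2 hk
  calc k * (Δ * Γ / r) ≤ k * (r / Γ / (800 * √k) * Γ / r) := by gcongr
    _ = √k * √k / (800 * √k) := by
        rw [Real.mul_self_sqrt hk.le]
        field_simp
    _ = √k / 800 := by field_simp

lemma centres_bound_le {D g k Δ r Γ d : ℝ} (hg : 1 ≤ g) (hD₀ : 0 ≤ D) (hD : D ≤ 5184 * g ^ 4)
    (hk : 0 < k) (hr : 0 < r) (hΓ : 0 < Γ) (hd : 0 < d) (hΔ : Δ < r / Γ / (800 * √k)) :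
    8 * (k * (D * Δ) / (r / (24 * Γ)) + 4 * D * k * (3 * g) / (d * (r / (24 * Γ)))) ≤
      2 * 10 ^ 7 * g ^ 5 * (√k + k * Γ / (r * d)) := by
  have : 0 < g := by linarith
  calc 8 * (k * (D * Δ) / (r / (24 * Γ)) + 4 * D * k * (3 * g) / (d * (r / (24 * Γ))))
      = 192 * D * (k * (Δ * Γ / r)) + 2304 * D * g * (k * Γ / (r * d)) := by
        field_simp
        ring
    _ ≤ 192 * D * (√k / 800) + 2304 * D * g * (k * Γ / (r * d)) := by
        gcongr
        exact card_mul_le_sqrt_of_lt hk hr hΓ hΔ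
    _ ≤ 192 * (5184 * g ^ 4) * (√k / 800) + 2304 * (5184 * g ^ 4) * g * (k * Γ / (r * d)) := by
        gcongr
    _ ≤ 192 * (5184 * g ^ 5) * (√k / 800) + 2304 * (5184 * g ^ 4) * g * (k * Γ / (r * d)) := by
        gcongr
        norm_num
    _ ≤ 2 * 10 ^ 7 * g ^ 5 * (√k + k * Γ / (r * d)) := by
        have hfst : 0 ≤ g ^ 5 * √k := by positivity
        have hsnd : 0 ≤ g ^ 5 * (k * Γ / (r * d)) := by positivity
        linarith

lemma scaled_cost_le {n A q m t g Z E : ℝ} (hn : 0 ≤ n) (hA : 1 ≤ A) (hg : 1 ≤ g)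
    (hq : q ≤ 2 * 10 ^ 6 * g) (hm₀ : 0 ≤ m) (hm : m ≤ A * E) (ht₀ : 0 ≤ t)
    (ht : t ≤ 2 * 10 ^ 7 * g ^ 5 * Z) (hZ : 1 ≤ Z) (hE : 0 ≤ E) :
    q * A * (60 * n + 18 * m) + 35 * (q * n * t) ≤ 10 ^ 16 * (A ^ 2 * g ^ 6) * (n * Z + E) := by
  have : 0 < A := by linarith
  have : 0 < g := by linarith
  have hgpow : g ≤ g ^ 6 := le_self_pow₀ hg (by norm_num)
  calc q * A * (60 * n + 18 * m) + 35 * (q * n * t)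
      ≤ 2 * 10 ^ 6 * g * A * (60 * (n * Z) + 18 * (A * E)) +
          35 * (2 * 10 ^ 6 * g * n * (2 * 10 ^ 7 * g ^ 5 * Z)) := by
        gcongr
        exact le_mul_of_one_le_right hn hZ
    _ = 12 * 10 ^ 7 * (A * g) * (n * Z) + 36 * 10 ^ 6 * (A ^ 2 * g) * E +
          14 * 10 ^ 14 * (1 * g ^ 6) * (n * Z) := by ring
    _ ≤ 12 * 10 ^ 7 * (A ^ 2 * g ^ 6) * (n * Z) + 36 * 10 ^ 6 * (A ^ 2 * g ^ 6) * E +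
          14 * 10 ^ 14 * (A ^ 2 * g ^ 6) * (n * Z) := by
        gcongr
        · exact le_self_pow₀ hA two_ne_zero
        · exact one_le_pow₀ hA
    _ ≤ 10 ^ 16 * (A ^ 2 * g ^ 6) * (n * Z + E) := by
        have hfst : 0 ≤ A ^ 2 * g ^ 6 * (n * Z) := by positivity
        have hsnd : 0 ≤ A ^ 2 * g ^ 6 * E := by positivity
        linarith

lemma mul_natLog_pow_le {b e : ℕ} {C : ℝ} (hn : 2 ≤ n) (hC : C ≤ 10 ^ 16) (hbe : b ≤ e) :
    C * (Nat.log 2 n + 1 : ℝ) ^ b ≤ 10 ^ 16 * 3 ^ e * Real.log n ^ e := by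
  have hone : (1 : ℝ) ≤ Nat.log 2 n + 1 := le_add_of_nonneg_left (Nat.cast_nonneg _)
  calc C * (Nat.log 2 n + 1 : ℝ) ^ b ≤ 10 ^ 16 * (Nat.log 2 n + 1 : ℝ) ^ e := by
        gcongr
    _ ≤ 10 ^ 16 * (3 * Real.log n) ^ e := by
        gcongr
        exact natLog_add_one_le_three_mul_log hn
    _ = _ := by rw [mul_pow, mul_assoc]

lemma le_div_six_mul_of_lt {k Δ r Γ : ℝ} (hk : 1 ≤ k) (hr : 0 < r) (hΓ : 0 < Γ)
    (hΔ : Δ < r / Γ / (800 * √k)) : Δ ≤ r / (6 * Γ) := by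
  have hsqrt : 1 ≤ √k := Real.one_le_sqrt.2 hk
  calc Δ ≤ r / Γ / (800 * √k) := hΔ.le
    _ ≤ r / Γ / 6 := by
        gcongr
        linarith
    _ = r / (6 * Γ) := by rw [div_div, mul_comm]

lemma sq_eight_mul_le {g : ℝ} (hg : 1 ≤ g) : (8 * (8 * g ^ 2 + 1)) ^ 2 ≤ 5184 * g ^ 4 :=
  calc (8 * (8 * g ^ 2 + 1)) ^ 2 ≤ (8 * (8 * g ^ 2 + g ^ 2)) ^ 2 := by
        gcongr
        exact one_le_pow₀ hg
    _ = 5184 * g ^ 4 := by ring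

lemma reff_le_mul_of_effRes_le {V : Type*} [Fintype V] [DecidableEq V] {L L' : Matrix V V ℝ}
    {u v : V} {c : ℝ} (hc : 0 ≤ c) (hL : L.PosSemidef) (huv : CarriesCurrent L u v)
    (hle : effRes L' u v ≤ ENNReal.ofReal c * effRes L u v) :
    CarriesCurrent L' u v ∧ reff L' u v ≤ c * reff L u v := by
  rw [effRes_eq_ofReal_reff huv, ← ENNReal.ofReal_mul hc] at hle
  have huv' := carriesCurrent_of_effRes_ne_top (ne_top_of_le_ne_top ENNReal.ofReal_ne_top hle)
  rw [effRes_eq_ofReal_reff huv',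
    ENNReal.ofReal_le_ofReal_iff (mul_nonneg hc (reff_nonneg hL huv))] at hle
  exact ⟨huv', hle⟩

lemma ofReal_one_sub_le_uniformOn_preservesNorm_currents (hn : 2 ≤ n) (H : WGraph n) :
    ENNReal.ofReal (1 - 1 / (n : ℝ) ^ 10) ≤ ProbabilityTheory.uniformOn Set.univ
      {Q : Signs n | ∀ u v, PreservesNorm Q (currents H u v)} := by
  have hbound := ofReal_one_sub_le_uniformOn_forall_preservesNorm
    (fun e : Fin n × Fin n => currents H e.1 e.2) (numRows n)
  simp only [Prod.forall, Fintype.card_prod, Fintype.card_fin, ← sq, Nat.cast_pow] at hbound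
  refine (ENNReal.ofReal_le_ofReal ?_).trans hbound
  linarith [two_mul_sq_mul_exp_numRows_le hn]

namespace LoopInv

variable {R : Fin n → Fin n → ℝ} {r : ℝ} {label : Fin n → Fin n} {X : LoopState n}
  {U : Finset (Fin n)}

lemma effRes_le (h : LoopInv R r label X U) {L : Matrix (Fin n) (Fin n) ℝ}
    (hL : IsNetworkLaplacian L) (hcurrent : ∀ u v, CarriesCurrent L u v)
    (hR : ∀ u v, reff L u v ≤ R u v) {P : Finset (Fin n)} (hP : P ∈ X.out) {u v : Fin n}
    (hu : u ∈ P) (hv : v ∈ P) : effRes L u v ≤ ENNReal.ofReal (2 * r) := by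
  obtain ⟨c, hc⟩ := h.exists_centre P hP
  rw [effRes_eq_ofReal_reff (hcurrent u v)]
  refine ENNReal.ofReal_le_ofReal ?_
  have htriangle := reff_triangle hL (hcurrent u c) (hcurrent c v)
  rw [reff_comm L u c] at htriangle
  linarith [hR c u, hR c v, hc u hu, hc v hv]

lemma card_centres_le (h : LoopInv R r label X U) {G : SimpleGraph (Fin n)} {k : ℕ}
    {cl : Fin n → Fin k} {Δ Γ γ d : ℝ} (hk : 1 ≤ k) (hr : 0 < r) (hΓ : 0 < Γ) (hd : 0 < d)
    (hΔ₀ : 0 < Δ) (hΔ : Δ < r / Γ / (800 * √k)) (hdiam : ∀ i, InducedDiamLE G {v | cl v = i} Δ)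
    (hγ : 0 ≤ γ) (hcurrent : ∀ u v, CarriesCurrent (lapReg G γ) u v)
    (hR : ∀ u v, R u v ≤ 3 * Γ * reff (lapReg G γ) u v)
    (hconn : ∀ u v, u ≠ v → label u = label v → d ≤ edgeConn G u v) :
    (U.card : ℝ) ≤ 2 * 10 ^ 7 * (Nat.log 2 n + 1 : ℝ) ^ 5 * (√k + k * Γ / (r * d)) := by
  let := resistanceMetric (isNetworkLaplacian_lapReg G hγ) hcurrent
  set g : ℝ := Nat.log 2 n + 1
  have hg₁ : 1 ≤ g := le_add_of_nonneg_left (Nat.cast_nonneg _)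
  have hk₁ : (1 : ℝ) ≤ k := mod_cast hk
  set δ : ℝ := (8 * (8 * g ^ 2 + 1))⁻¹ with hδ
  have hδ₀ : 0 < δ := by positivity
  have hδ₁ : δ ≤ 1 := inv_le_one_of_one_le₀ (by nlinarith)
  have hgδ : (32 * g ^ 2 + 5) * δ < 1 := by
    rw [← div_eq_mul_inv, div_lt_one (by positivity)]
    linarith [sq_nonneg g]
  set ρ := r / (24 * Γ) with hρ
  have hρ₀ : 0 < ρ := by positivity
  have hscale {t : ℝ} {u v : Fin n} (huv : t < R u v) : t / (3 * Γ) < dist u v :=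
    (div_lt_iff₀' (by positivity)).2 (huv.trans_le (hR u v))
  have hΔρ : Δ ≤ 4 * ρ := (le_div_six_mul_of_lt hk₁ hr hΓ hΔ).trans_eq (by
    rw [hρ]
    field_simp
    norm_num)
  have hΔθ : Δ ≤ Δ / δ ^ 2 := le_div_self hΔ₀.le (by positivity) (pow_le_one₀ hδ₀.le hδ₁)
  have hlong := sum_heavyPairs_reff_le hγ hcurrent hdiam hΔ₀ (Nat.le_add_left 1 (Nat.log 2 n))
    (by simpa using Nat.lt_pow_succ_log_self one_lt_two n) hδ₀ (by simpa using hgδ)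
  refine (card_le_of_separated G
    (fun u v huv => (hdiam (cl v)).reff_le hΔ₀.le hγ huv rfl (hcurrent u v)) hΔρ hΔθ
    (by positivity) hρ₀ hd hlong U (fun u hu v hv hne => ?_) fun u hu => ?_).trans ?_
  · exact (hscale (h.separated hu hv hne)).trans_eq' (by rw [hρ]; field_simp; norm_num)
  · obtain ⟨v, hlabel, hfar⟩ := h.exists_far u hu
    have hρv : ρ < dist u v := (hscale hfar).trans' (by
      rw [hρ, div_div]
      exact div_lt_div_of_pos_left hr (by positivity) (by linarith))
    refine ⟨v, hρv, hconn u v ?_ hlabel.symm⟩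
    rintro rfl
    exact (hρ₀.trans hρv).ne' (dist_self u)
  · have hD : (1 / δ ^ 2) ≤ 5184 * g ^ 4 := by
      simpa only [hδ, inv_pow, one_div, inv_inv] using sq_eight_mul_le hg₁
    refine le_of_eq_of_le ?_
      (centres_bound_le hg₁ (by positivity) hD (by positivity) hr hΓ hd hΔ)
    rw [Fintype.card_fin, Nat.cast_succ]
    ring

end LoopInv

lemma removeEdges_time_le {a s : ℕ} (hs : s ≤ (Nat.log 2 n + 1) ^ a)
    (S : Matrix (Fin s) (Pairs n) ℝ) (Y : Matrix (Fin s) (Fin n) ℝ) (F : Finset (Pairs n)) :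
    ((removeEdges S Y F).time : ℝ) ≤ 11 * (Nat.log 2 n + 1 : ℝ) ^ a * F.card := by
  have hpos : 1 ≤ (Nat.log 2 n + 1) ^ a := Nat.one_le_pow _ _ (Nat.succ_pos _)
  rw [removeEdges_time, mul_comm]
  exact_mod_cast Nat.mul_le_mul_right F.card (by lia : 1 + 10 * s ≤ 11 * (Nat.log 2 n + 1) ^ a)

lemma ballCarving_space_le_time (a : ℕ) {s : ℕ} (S : Matrix (Fin s) (Pairs n) ℝ)
    (decode : Matrix (Fin s) (Fin n) ℝ → Fin n → Fin n) (Y : Matrix (Fin s) (Fin n) ℝ)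
    (F : Finset (Pairs n)) (r : ℝ) (H : WGraph n) (π : Equiv.Perm (Fin n)) (Q : Signs n) :
    (ballCarving a S decode Y F r H π Q).space ≤
      (carveFromSketch a decode (removeEdges S Y F).val r H π Q).time := by
  rw [ballCarving, bind_space, removeEdges_space, zero_add]
  exact spaceLeTime_carveFromSketch ..

lemma time_le_of_card_le {a m t T : ℕ} {k Γ r d ε : ℝ} (hk : 1 ≤ k) (hΓ : 0 < Γ) (hr : 0 < r)
    (hd : 0 < d) (hε : 0 < ε) (hm : (m : ℝ) ≤ (Nat.log 2 n + 1 : ℝ) ^ a * (n / ε ^ 2))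
    (ht : (t : ℝ) ≤ 2 * 10 ^ 7 * (Nat.log 2 n + 1 : ℝ) ^ 5 * (√k + k * Γ / (r * d)))
    (hT : T ≤ numRows n * (Nat.log 2 n + 1) ^ a * (60 * n + 18 * m) + 35 * (numRows n * n * t)) :
    (T : ℝ) ≤ 10 ^ 16 * (Nat.log 2 n + 1 : ℝ) ^ (2 * a + 6) *
      (n * √k + n * (k * Γ / (r * d)) + n / ε ^ 2) := by
  have hg : (1 : ℝ) ≤ Nat.log 2 n + 1 := le_add_of_nonneg_left (Nat.cast_nonneg _)
  have hZ : 1 ≤ √k + k * Γ / (r * d) :=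
    (Real.one_le_sqrt.2 hk).trans (le_add_of_nonneg_right (by positivity))
  rw [pow_add, mul_comm 2 a, pow_mul, ← mul_add]
  exact (mod_cast hT : (T : ℝ) ≤ _).trans (scaled_cost_le (Nat.cast_nonneg n) (one_le_pow₀ hg) hg
    (numRows_le n) (Nat.cast_nonneg m) hm (Nat.cast_nonneg t) ht hZ (by positivity))

lemma two_le_of_pos_of_le_one_div_log {r : ℝ} (hr : 0 < r) (hrn : r ≤ 1 / Real.log n) :
    2 ≤ n := by
  by_contra! hn
  have hlog : Real.log n = 0 := by interval_cases n <;> simp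
  rw [hlog, div_zero] at hrn
  exact hrn.not_gt hr

theorem mainTheorem5_general (a : ℕ) :
    ∃ (K : ℝ) (c : ℕ), 0 < K ∧
      ∀ (n : ℕ) (G : SimpleGraph (Fin n)) (F : Finset (Pairs n)) (d Γ r Δ γ ε : ℝ) (k : ℕ)
        (cl : Fin n → Fin k) (H : WGraph n) (s : ℕ) (S : Matrix (Fin s) (Pairs n) ℝ)
        (decode : Matrix (Fin s) (Fin n) ℝ → Fin n → Fin n) (π : Equiv.Perm (Fin n)),
        2 ≤ n → (∀ e ∈ F, e.1 ∈ G.edgeSet) → 0 < d → 0 < Γ → 0 < r →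
        0 < Δ → Δ < r / Γ / (800 * √k) → (∀ i, InducedDiamLE G {v | cl v = i} Δ) →
        0 ≤ γ → (0 < γ ∨ G.Connected) →
        (∀ u v, effRes H.laplacian u v ≤ ENNReal.ofReal (2 * Γ) * effRes (lapReg G γ) u v) →
        0 < ε → (H.edges.card : ℝ) ≤ (Nat.log 2 n + 1 : ℝ) ^ a * (n / ε ^ 2) →
        (∀ e : Pairs n, ∀ u v, e.1 = s(u, v) → G.Adj u v → (edgeConn G u v : ℝ) ≤ d → e ∈ F) →
        s ≤ (Nat.log 2 n + 1) ^ a →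
        (∀ u v, decode (S * incidence (without G F)) u = decode (S * incidence (without G F)) v →
          (without G F).Reachable u v) →
        ENNReal.ofReal (1 - 1 / (n : ℝ) ^ 10) ≤
          ProbabilityTheory.uniformOn (Set.univ : Set (Signs n)) {Q |
            let Y := S * incidence G
            let run := ballCarving a S decode Y F r H π Q
            run.val.Pairwise Disjoint ∧
            (∀ P ∈ run.val, ∀ u ∈ P, ∀ v ∈ P, effRes H.laplacian u v ≤ ENNReal.ofReal (2 * r)) ∧
            (run.val.length : ℝ) ≤ K * Real.log n ^ c * (√k + k * Γ / (r * d)) ∧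
            ((removeEdges S Y F).time : ℝ) ≤ K * Real.log n ^ c * F.card ∧
            ((carveFromSketch a decode (removeEdges S Y F).val r H π Q).time : ℝ) ≤
              K * Real.log n ^ c * (n * √k + n * (k * Γ / (r * d)) + n / ε ^ 2) ∧
            (run.space : ℝ) ≤
              K * Real.log n ^ c * (n * √k + n * (k * Γ / (r * d)) + n / ε ^ 2)} := by
  refine ⟨10 ^ 16 * 3 ^ (2 * a + 6), 2 * a + 6, by positivity, fun n G F d Γ r Δ γ ε k cl H s S
    decode π hn hF hd hΓ hr hΔ₀ hΔ hdiam hγ hconn hH hε hm hlow hs hdecode => ?_⟩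
  refine (ofReal_one_sub_le_uniformOn_preservesNorm_currents hn H).trans
    (MeasureTheory.measure_mono fun Q hQ => ?_)
  have hk : 1 ≤ k := Fin.pos (cl ⟨0, by lia⟩)
  have hcurrent (u v) : CarriesCurrent (lapReg G γ) u v :=
    carriesCurrent_lapReg hγ (hconn.imp_right fun h => h.preconnected u v)
  have hreff (u v) := reff_le_mul_of_effRes_le (by positivity)
    (isNetworkLaplacian_lapReg G hγ).posSemidef (hcurrent u v) (hH u v)
  have hM (u v) := resM_embedding_mem_Icc a (numRows_pos hn) (hreff u v).1 (hQ u v)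
  obtain ⟨X, U, hval, hinv, htime⟩ := exists_loopInv_carveFromSketch hn hs decode
    (removeEdges S (S * incidence G) F).val hr.le H π Q
  have hcard := hinv.card_centres_le hk hr hΓ hd hΔ₀ hΔ hdiam hγ hcurrent
    (fun u v => (hM u v).2.trans (by linarith [(hreff u v).2])) fun u v hne huv =>
      (lt_edgeConn_of_reachable_without hlow hne
        (hdecode u v (removeEdges_val S hF ▸ huv))).le
  have hcost := time_le_of_card_le (mod_cast hk) hΓ hr hd hε hm hcard htime
  have hlog {b : ℕ} {C x : ℝ} (hC : C ≤ 10 ^ 16) (hb : b ≤ 2 * a + 6) (hx : 0 ≤ x) :=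
    mul_le_mul_of_nonneg_right (mul_natLog_pow_le hn hC hb) hx
  have htotal := hcost.trans (hlog le_rfl le_rfl (by positivity))
  have hout : (ballCarving a S decode (S * incidence G) F r H π Q).val = X.out := hval
  have hlength : (ballCarving a S decode (S * incidence G) F r H π Q).val.length = U.card :=
    hout ▸ hinv.card_eq.symm
  refine ⟨hout ▸ hinv.pairwise_disjoint, fun P hP u hu v hv =>
    hinv.effRes_le H.isNetworkLaplacian_laplacian (fun u v => (hreff u v).1)
      (fun u v => (hM u v).1) (hout ▸ hP) hu hv, ?_, ?_, htotal, ?_⟩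
  · exact hlength ▸ hcard.trans (hlog (by norm_num) (by lia) (by positivity))
  · exact (removeEdges_time_le hs _ _ F).trans (hlog (by norm_num) (by lia) (by positivity))
  · exact (Nat.cast_le.2 (ballCarving_space_le_time ..)).trans htotal

end BallCarving

end

open BallCarving in
theorem mainTheorem5 (a : ℕ) :
    ∃ (K : ℝ) (c : ℕ), 0 < K ∧
      ∀ (n : ℕ) (G : SimpleGraph (Fin n)) (F : Finset (Pairs n)) (d Γ r Δ γ ε : ℝ) (k : ℕ)
        (cl : Fin n → Fin k) (H : WGraph n) (s : ℕ) (S : Matrix (Fin s) (Pairs n) ℝ)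
        (decode : Matrix (Fin s) (Fin n) ℝ → Fin n → Fin n) (π : Equiv.Perm (Fin n)),
        -- `F` is a set of edges of `G`
        (∀ e ∈ F, e.1 ∈ G.edgeSet) →
        -- the minimum degree is at least `d`
        1 ≤ d → (∀ v, d ≤ deg G v) →
        -- the clusters have small induced effective resistance diameter
        1 ≤ Γ → 0 < r → r ≤ 1 / Real.log n → 1 ≤ k →
        0 < Δ → Δ < 1 → Δ < r / Γ / (800 * Real.sqrt k) →
        (∀ i, InducedDiamLE G {v | cl v = i} Δ) →
        -- `H` is a coarse approximation of the connected network `G^γ`, with few edges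
        0 ≤ γ → (0 < γ ∨ G.Connected) →
        (∀ u v, effRes (lapReg G γ) u v ≤ effRes H.laplacian u v ∧
          effRes H.laplacian u v ≤ ENNReal.ofReal (2 * Γ) * effRes (lapReg G γ) u v) →
        0 < ε → (H.edges.card : ℝ) ≤ (Nat.log 2 n + 1 : ℝ) ^ a * (n / ε ^ 2) →
        -- `F` contains all edges of connectivity at most `d`
        (∀ e : Pairs n, ∀ u v, e.1 = s(u, v) → G.Adj u v → (edgeConn G u v : ℝ) ≤ d → e ∈ F) →
        -- `S` is a sketching matrix from which the components of `G` without `F` are decoded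
        s ≤ (Nat.log 2 n + 1) ^ a →
        (∀ u v, decode (S * incidence (without G F)) u = decode (S * incidence (without G F)) v ↔
          (without G F).Reachable u v) →
        ENNReal.ofReal (1 - 1 / (n : ℝ) ^ 10) ≤
          ProbabilityTheory.uniformOn (Set.univ : Set (Signs n)) {Q |
            let Y := S * incidence G
            let run := ballCarving a S decode Y F r H π Q
            run.val.Pairwise Disjoint ∧
            (∀ P ∈ run.val, ∀ u ∈ P, ∀ v ∈ P, effRes H.laplacian u v ≤ ENNReal.ofReal (2 * r)) ∧
            ((run.val.filter fun P => P.card ≠ 1).length : ℝ) ≤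
              K * Real.log n ^ c * (Real.sqrt k + k * Γ / (r * d)) ∧
            ((removeEdges S Y F).time : ℝ) ≤ K * Real.log n ^ c * F.card ∧
            ((carveFromSketch a decode (removeEdges S Y F).val r H π Q).time : ℝ) ≤
              K * Real.log n ^ c *
                (n * Real.sqrt k + n * (k * Γ / (r * d)) + n / ε ^ 2) ∧
            (run.space : ℝ) ≤
              K * Real.log n ^ c *
                (n * Real.sqrt k + n * (k * Γ / (r * d)) + n / ε ^ 2)} := by
  obtain ⟨K, c, hK, hgeneral⟩ := mainTheorem5_general a
  refine ⟨K, c, hK, fun n G F d Γ r Δ γ ε k cl H s S decode π hF hd _ hΓ hr hrn _ hΔ₀ _ hΔ hdiam hγ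
    hconn hH hε hm hlow hs hdecode => ?_⟩
  refine (hgeneral n G F d Γ r Δ γ ε k cl H s S decode π (two_le_of_pos_of_le_one_div_log hr hrn) hF
    (by linarith) (by linarith) hr hΔ₀ hΔ hdiam hγ hconn (fun u v => (hH u v).2) hε hm hlow hs
    fun u v => (hdecode u v).1).trans (MeasureTheory.measure_mono ?_)
  rintro Q ⟨hdisj, hres, hlength, hcost⟩
  exact ⟨hdisj, hres, (Nat.cast_le.2 (List.length_filter_le ..)).trans hlength, hcost⟩
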